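/- Let $d\ge 3$, let $\mu$ be the uniform probability distribution on the unit sphere $\mathbb S^{d-1}\subset\mathbb R^d$, let $h(u)=\frac{u}{2\pi}(\pi-\arccos u)$ for $u\in[-1,1]$, and let $\mathsf\Phi$ be the integral operator on the real space $L^2(\mu)$ with kernel $\Phi(x,x')=h(\langle x,x'\rangle)$, that is, $\mathsf\Phi g(x)=\int \Phi(x,x')\,g(x')\,\mu(dx')$. For $\ell\ge 0$ let $\mathcal H_\ell\subset L^2(\mu)$ be the space of restrictions to $\mathbb S^{d-1}$ of real homogeneous polynomials $P$ of degree $\ell$ in $d$ variables with $\Delta P=0$, and let $(Y_{\ell,i})_{1\le i\le N_\ell}$ be any orthonormal basis of $\mathcal H_\ell$. With $(a)_n=a(a+1)\cdots(a+n-1)$, put $$\beta_\ell=\frac{d-2}{2}\sum_{m=0}^{\infty}\frac{h^{(\ell+2m)}(0)}{2^{\ell+2m}\,m!\,\left(\frac{d-2}{2}\right)_{\ell+m+1}} .$$ Then: 1. $N_\ell=\dim\mathcal H_\ell=\frac{\ell+\lambda}{\lambda}C^\lambda_\ell(1)$ for all $\ell\ge0$, where $\lambda=\frac{d-2}{2}$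 and $C^\lambda_n(x)=\frac{(2\lambda)_n}{n!}\sum_{k=0}^n(-1)^k\binom nk\frac{(n+2\lambda)_k}{(\lambda+1/2)_k}\left(\frac{1-x}{2}\right)^k$ is the Gegenbauer polynomial. 2. The series defining each $\beta_\ell$ converges absolutely, and $\mathsf\Phi Y_{\ell,i}=\beta_\ell Y_{\ell,i}$ for all $\ell\ge 0$, $1\le i\le N_\ell$. The family $(Y_{\ell,i})_{\ell\ge0,\,1\le i\le N_\ell}$ is a complete orthonormal system of $L^2(\mu)$, and the set of eigenvalues of $\mathsf\Phi$ is $\{\beta_\ell:\ell\ge0\}$. If $\ell=1$ or $\ell$ is even, then $\beta_\ell>0$ and the eigenspace of $\mathsf\Phi$ for $\beta_\ell$ is exactly $\mathcal H_\ell$, so that $\beta_\ell$ has multiplicity $N_\ell$. The kernel of $\mathsf\Phi$ is the closed linear span of the spaces $\mathcal H_{2k+1}$, $k\ge1$. 3. $\beta_{2k+1}=0$ for all $k\ge1$, $\beta_\ell\le\beta_{\ell-2}$ for all $\ell\ge2$, and $\beta_1=\frac1{4d}>\beta_0$. 4. Let $\lambda_k$ be the $k$-th largest distinct eigenvalue of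 $\mathsf\Phi$ (an eigenvalue with exactly $k-1$ distinct eigenvalues above it). Then $\lambda_k$ exists for every $k\ge1$, $\lambda_1=\beta_1$, and $\lambda_k=\beta_{2(k-2)}$ for every $k\ge2$. -/

import Mathlib

open MeasureTheory

noncomputable section

namespace NTKSphere

/-- The unit sphere of `ℝ^d`, with the Euclidean norm. -/
abbrev Sph (d : ℕ) : Type := Metric.sphere (0 : EuclideanSpace ℝ (Fin d)) 1

/-- The uniform probability distribution on the unit sphere: normalized surface measure. -/
def unif (d : ℕ) : Measure (Sph d) :=
  ((volume : Measure (EuclideanSpace ℝ (Fin d))).toSphere Set.univ)⁻¹ •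
    (volume : Measure (EuclideanSpace ℝ (Fin d))).toSphere

instance unif_isFiniteMeasure (d : ℕ) : IsFiniteMeasure (unif d) := by
  constructor
  rw [unif, Measure.smul_apply, smul_eq_mul]
  exact lt_of_le_of_lt (ENNReal.inv_mul_le_one _) ENNReal.one_lt_top

theorem unif_isProbabilityMeasure (d : ℕ) (hd : 1 ≤ d) : IsProbabilityMeasure (unif d) := by
  constructor
  have : Nonempty (Fin d) := ⟨⟨0, hd⟩⟩
  rw [unif, Measure.smul_apply, smul_eq_mul]
  refine ENNReal.inv_mul_cancel ?_ (measure_ne_top _ _)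
  rw [Measure.toSphere_apply_univ]
  refine mul_ne_zero ?_ (Metric.measure_ball_pos _ _ one_pos).ne'
  simp [(Nat.pos_of_ne_zero (by omega : d ≠ 0)).ne']

/-- The Hilbert space `L²(μ)`, where `μ` is the uniform distribution on the sphere. -/
abbrev L2 (d : ℕ) : Type := Lp ℝ 2 (unif d)

/-- The profile `h(u) = u (π - arccos u) / (2π)`. -/
def profile (u : ℝ) : ℝ := u * (Real.pi - Real.arccos u) / (2 * Real.pi)

/-- The kernel `Φ(x, y) = h(⟨x, y⟩)` on the sphere. -/
def kernel (d : ℕ) (x y : Sph d) : ℝ :=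
  profile (inner ℝ (x : EuclideanSpace ℝ (Fin d)) (y : EuclideanSpace ℝ (Fin d)))

theorem continuous_profile : Continuous profile := by
  unfold profile
  have := Real.continuous_arccos
  fun_prop

theorem continuous_kernel (d : ℕ) :
    Continuous (fun p : Sph d × Sph d => kernel d p.1 p.2) := by
  unfold kernel
  have := continuous_profile
  fun_prop

theorem exists_kernel_bound (d : ℕ) : ∃ C : ℝ, ∀ x y : Sph d, ‖kernel d x y‖ ≤ C := by
  obtain ⟨C, hC⟩ := isCompact_univ.exists_bound_of_continuousOn
    (continuous_kernel d).continuousOn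
  exact ⟨C, fun x y => hC (x, y) (Set.mem_univ _)⟩

theorem integrable_L2 (d : ℕ) (g : L2 d) : Integrable g (unif d) :=
  (Lp.memLp g).integrable one_le_two

theorem integrable_kernel_mul (d : ℕ) (g : L2 d) (x : Sph d) :
    Integrable (fun y => kernel d x y * g y) (unif d) := by
  obtain ⟨C, hC⟩ := exists_kernel_bound d
  refine (integrable_L2 d g).bdd_mul (c := C) ?_ (Filter.Eventually.of_forall (hC x))
  exact ((continuous_kernel d).comp (by fun_prop : Continuous fun y : Sph d => (x, y))
    ).aestronglyMeasurable

/-- The function `x ↦ ∫ Φ(x, y) g(y) μ(dy)`, which is continuous on the sphere. -/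
def kernelIntegral (d : ℕ) (g : L2 d) : C(Sph d, ℝ) where
  toFun x := ∫ y, kernel d x y * g y ∂(unif d)
  continuous_toFun := by
    obtain ⟨C, hC⟩ := exists_kernel_bound d
    refine continuous_of_dominated (bound := fun y => C * ‖g y‖)
      (fun x => (integrable_kernel_mul d g x).aestronglyMeasurable) ?_
      ((integrable_L2 d g).norm.const_mul C) ?_
    · intro x
      refine Filter.Eventually.of_forall fun y => ?_
      rw [norm_mul]
      exact mul_le_mul_of_nonneg_right (hC x y) (norm_nonneg _)
    · refine Filter.Eventually.of_forall fun y => ?_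
      exact ((continuous_kernel d).comp
        (by fun_prop : Continuous fun x : Sph d => (x, y))).mul continuous_const

/-- The integral operator on `L²(μ)` with kernel `Φ`:
it maps `g` to the class of `x ↦ ∫ Φ(x, y) g(y) μ(dy)`. -/
def integralOp (d : ℕ) : Module.End ℝ (L2 d) where
  toFun g := ContinuousMap.toLp 2 (unif d) ℝ (kernelIntegral d g)
  map_add' f g := by
    rw [← map_add]
    congr 1
    ext x
    simp only [kernelIntegral, ContinuousMap.coe_mk, ContinuousMap.add_apply]
    rw [← integral_add (integrable_kernel_mul d f x) (integrable_kernel_mul d g x)]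
    refine integral_congr_ae ?_
    filter_upwards [Lp.coeFn_add f g] with y hy
    rw [hy, Pi.add_apply, mul_add]
  map_smul' c g := by
    rw [RingHom.id_apply, ← map_smul]
    congr 1
    ext x
    simp only [kernelIntegral, ContinuousMap.coe_mk, ContinuousMap.smul_apply, smul_eq_mul]
    rw [← integral_const_mul]
    refine integral_congr_ae ?_
    filter_upwards [Lp.coeFn_smul c g] with y hy
    rw [hy, Pi.smul_apply, smul_eq_mul]
    ring

theorem integralOp_ae (d : ℕ) (g : L2 d) :
    integralOp d g =ᵐ[unif d] fun x => ∫ y, kernel d x y * g y ∂(unif d) :=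
  ContinuousMap.coeFn_toLp (unif d) (kernelIntegral d g)

/-- The Laplacian `∑ i, ∂² / ∂x_i²` on real polynomials in `d` variables. -/
def polyLaplacian (d : ℕ) : MvPolynomial (Fin d) ℝ →ₗ[ℝ] MvPolynomial (Fin d) ℝ :=
  ∑ i : Fin d, (MvPolynomial.pderiv i).toLinearMap ∘ₗ (MvPolynomial.pderiv i).toLinearMap

/-- Homogeneous harmonic real polynomials of degree `ℓ` in `d` variables (including `0`). -/
def harmonicPoly (d ℓ : ℕ) : Submodule ℝ (MvPolynomial (Fin d) ℝ) :=
  MvPolynomial.homogeneousSubmodule (Fin d) ℝ ℓ ⊓ LinearMap.ker (polyLaplacian d)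

/-- The `i`-th coordinate function on the sphere. -/
def coord (d : ℕ) (i : Fin d) : C(Sph d, ℝ) where
  toFun x := (x : EuclideanSpace ℝ (Fin d)) i
  continuous_toFun := by fun_prop

/-- Restriction of a polynomial to the sphere. -/
def restrictSphere (d : ℕ) : MvPolynomial (Fin d) ℝ →ₗ[ℝ] C(Sph d, ℝ) :=
  (MvPolynomial.aeval (coord d)).toLinearMap

theorem restrictSphere_apply (d : ℕ) (P : MvPolynomial (Fin d) ℝ) (x : Sph d) :
    restrictSphere d P x = MvPolynomial.eval (fun i => (x : EuclideanSpace ℝ (Fin d)) i) P := by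
  induction P using MvPolynomial.induction_on with
  | C a => simp [restrictSphere]
  | add p q hp hq => simp [hp, hq]
  | mul_X p i hp =>
    have : restrictSphere d (p * MvPolynomial.X i) = restrictSphere d p * coord d i := by
      simp [restrictSphere]
    rw [this, ContinuousMap.mul_apply, hp]
    simp [coord]

/-- The space `𝓗_ℓ` of spherical harmonics of degree `ℓ`: restrictions to the sphere of
homogeneous harmonic polynomials of degree `ℓ`, as a subspace of `L²(μ)`. -/
def harmonics (d ℓ : ℕ) : Submodule ℝ (L2 d) :=
  ((harmonicPoly d ℓ).map (restrictSphere d)).map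
    (ContinuousMap.toLp 2 (unif d) ℝ : C(Sph d, ℝ) →L[ℝ] L2 d).toLinearMap

/-- The Pochhammer symbol `(a)_n = a (a + 1) ⋯ (a + n - 1)`. -/
def poch (a : ℝ) (n : ℕ) : ℝ := (ascPochhammer ℝ n).eval a

/-- The Gegenbauer polynomial `C^lam_n`. -/
def gegenbauer (lam : ℝ) (n : ℕ) (x : ℝ) : ℝ :=
  poch (2 * lam) n / (n.factorial : ℝ) *
    ∑ k ∈ Finset.range (n + 1), (-1 : ℝ) ^ k * (n.choose k : ℝ) *
      (poch ((n : ℝ) + 2 * lam) k / poch (lam + 1 / 2) k) * ((1 - x) / 2) ^ k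

/-- `N_ℓ = ((ℓ + lam) / lam) C^lam_ℓ(1)` with `lam = (d - 2) / 2`. -/
def harmonicsDim (d ℓ : ℕ) : ℝ :=
  ((ℓ : ℝ) + ((d : ℝ) - 2) / 2) / (((d : ℝ) - 2) / 2) * gegenbauer (((d : ℝ) - 2) / 2) ℓ 1

/-- The `m`-th term of the series that defines `β_ℓ(h)`, without the prefactor `(d - 2) / 2`. -/
def betaTerm (d : ℕ) (h : ℝ → ℝ) (ℓ m : ℕ) : ℝ :=
  iteratedDeriv (ℓ + 2 * m) h 0 /
    ((2 : ℝ) ^ (ℓ + 2 * m) * (m.factorial : ℝ) * poch (((d : ℝ) - 2) / 2) (ℓ + m + 1))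

/-- `β_ℓ(h) = ((d - 2) / 2) ∑_{m ≥ 0} h^{(ℓ+2m)}(0) / (2^{ℓ+2m} m! ((d-2)/2)_{ℓ+m+1})`. -/
def betaOf (d : ℕ) (h : ℝ → ℝ) (ℓ : ℕ) : ℝ :=
  ((d : ℝ) - 2) / 2 * ∑' m : ℕ, betaTerm d h ℓ m

/-- `β_ℓ` for the profile `h(u) = u (π - arccos u) / (2π)`. -/
def beta (d ℓ : ℕ) : ℝ := betaOf d profile ℓ

/-- `c` is the `k`-th largest distinct eigenvalue of `T` (`k = 1, 2, …`):
it is an eigenvalue, and exactly `k - 1` distinct eigenvalues are greater than `c`. -/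
def IsKthLargestEigenvalue {V : Type*} [AddCommGroup V] [Module ℝ V]
    (T : Module.End ℝ V) (k : ℕ) (c : ℝ) : Prop :=
  T.HasEigenvalue c ∧ {c' : ℝ | T.HasEigenvalue c' ∧ c < c'}.encard + 1 = (k : ℕ∞)

end NTKSphere

end

open NTKSphere

open MeasureTheory

noncomputable section

namespace NTKSphere

open Filter Topology

/-! The profile is a power series `h(u) = ∑ aₙ uⁿ` with `aₙ ≥ 0`, convergent on all of `[-1, 1]`:
from `π - arccos u = π/2 + arcsin u` one gets `a₁ = 1/4`, positive coefficients at the even indices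
`≥ 2`, and zeros elsewhere (`hasSum_profile`). The operator is thus a sum of operators with kernels
`⟨x, y⟩ⁿ`. Such a kernel acts on `𝓗_ℓ` as a scalar, which is `funkCoeff lam ℓ m` if `n = ℓ + 2m` and
zero for every other `n` (`sphereInt_linForm_pow_mul`, `sphereInt_linForm_pow_mul_eq_zero`). Summing
over `n` gives `β_ℓ`.

The harmonic analysis rests on one identity, `sphereInt_laplacian`: for `P` homogeneous of degree
`n`, the mean of `ΔP` is `n(n + d - 2)` times the mean of `P`. It follows from Gaussian integration
by parts and polar coordinates. Induction on the degree then gives orthogonality of the `𝓗_ℓ` and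
the Funk–Hecke formula for powers; orthogonality makes `Q ↦ Δ(|x|² Q)` bijective, whence the
harmonic decomposition and the dimensions. Stone–Weierstrass gives completeness.

A symmetric operator that is scalar on mutually orthogonal subspaces with dense sum has closed spans
of these as eigenspaces (`eigenspace_eq_topologicalClosure`). The order of the `β_ℓ` is then a
termwise comparison: a given power of `u` contributes less to `𝓗_{ℓ+2}` than to `𝓗_ℓ`
(`funkCoeff_add_two_left_lt`), and `β₀ < β₁` because the even `aₙ` sum to `1/4` and each is weighted
by at most `1/d`. -/

/-! ### Power series of arcsin and of the profile -/

/-- The coefficients `(1/2)_k / k!` of the power series of `v ↦ (1 - v) ^ (-1/2)`. -/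
def invSqrtCoeff (k : ℕ) : ℝ := Ring.choose ((1 / 2 : ℝ) + k - 1) k

theorem invSqrtCoeff_pos (k : ℕ) : 0 < invSqrtCoeff k := by
  have h := Ring.factorial_nsmul_multichoose_eq_ascPochhammer (1 / 2 : ℝ) k
  have h2 : Ring.multichoose (1 / 2 : ℝ) k = invSqrtCoeff k := by
    rw [invSqrtCoeff, Ring.choose]
    congr 1
    ring
  rw [h2, Polynomial.ascPochhammer_smeval_eq_eval, nsmul_eq_mul] at h
  have h3 : 0 < (k.factorial : ℝ) * invSqrtCoeff k := by
    rw [h]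
    exact ascPochhammer_pos k _ (by norm_num)
  exact pos_of_mul_pos_right h3 (by positivity)

theorem hasSum_invSqrtCoeff {v : ℝ} (hv : |v| < 1) :
    HasSum (fun k => invSqrtCoeff k * v ^ k) (1 / √(1 - v)) := by
  have h := (Real.one_div_one_sub_rpow_hasFPowerSeriesOnBall_zero (1 / 2)).hasSum (y := v)
    (by simpa [enorm_eq_nnnorm, ← NNReal.coe_lt_coe] using hv)
  rw [zero_add, ← Real.sqrt_eq_rpow] at h
  refine h.congr_fun ?_
  intro k
  simp [invSqrtCoeff, mul_comm]

/-- The coefficient of `u ^ (2 k + 1)` in the power series of `arcsin`. -/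
def arcsinCoeff (k : ℕ) : ℝ := invSqrtCoeff k / (2 * k + 1)

theorem arcsinCoeff_pos (k : ℕ) : 0 < arcsinCoeff k :=
  div_pos (invSqrtCoeff_pos k) (by positivity)

/-- The series of `(1 - y²)^(-1/2)` is integrated term by term: on a ball of radius `r < 1` the
differentiated series is dominated by its value at `r`, so the sum has the derivative of `arcsin`,
and both vanish at `0`. -/
theorem hasSum_arcsin_of_lt {u : ℝ} (hu : |u| < 1) :
    HasSum (fun k => arcsinCoeff k * u ^ (2 * k + 1)) (Real.arcsin u) := by
  obtain ⟨r, hur, hr⟩ := exists_between hu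
  have hr0 : 0 < r := (abs_nonneg u).trans_lt hur
  have hr2 : |r ^ 2| < 1 := by
    rw [abs_of_nonneg (by positivity)]; nlinarith
  have hsq : ∀ y ∈ Metric.ball (0 : ℝ) r, |y ^ 2| < 1 := by
    intro y hy
    rw [Metric.mem_ball, dist_zero_right, Real.norm_eq_abs] at hy
    rw [abs_pow]
    have := abs_nonneg y
    nlinarith
  have hsum : Summable (fun k => invSqrtCoeff k * (r ^ 2) ^ k) := (hasSum_invSqrtCoeff hr2).summable
  have hder : ∀ y ∈ Metric.ball (0 : ℝ) r,
      HasDerivAt (fun z => ∑' k, arcsinCoeff k * z ^ (2 * k + 1)) (1 / √(1 - y ^ 2)) y := by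
    intro y hy
    rw [← (hasSum_invSqrtCoeff (hsq y hy)).tsum_eq]
    refine hasDerivAt_tsum_of_isPreconnected hsum Metric.isOpen_ball
      (g := fun k z => arcsinCoeff k * z ^ (2 * k + 1)) (g' := fun k z => invSqrtCoeff k * (z ^ 2) ^ k)
      (convex_ball (0 : ℝ) r).isPreconnected ?_ ?_ (Metric.mem_ball_self hr0) ?_ hy
    · intro k y _
      refine ((hasDerivAt_pow (2 * k + 1) y).const_mul (arcsinCoeff k)).congr_deriv ?_
      rw [arcsinCoeff, ← pow_mul]
      push_cast
      have : (2 * (k : ℝ) + 1) ≠ 0 := by positivity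
      field_simp
    · intro k y hy
      rw [Metric.mem_ball, dist_zero_right, Real.norm_eq_abs] at hy
      rw [norm_mul, norm_pow, norm_pow, Real.norm_of_nonneg (invSqrtCoeff_pos k).le,
        Real.norm_eq_abs]
      have := (invSqrtCoeff_pos k).le
      gcongr
    · simp
  have hball : ∀ y ∈ Metric.ball (0 : ℝ) r, y ≠ -1 ∧ y ≠ 1 := by
    intro y hy
    have := hsq y hy
    constructor <;> rintro rfl <;> norm_num at this
  have heq : Set.EqOn (fun z => ∑' k, arcsinCoeff k * z ^ (2 * k + 1)) Real.arcsin
      (Metric.ball (0 : ℝ) r) := by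
    refine Metric.isOpen_ball.eqOn_of_deriv_eq (convex_ball (0 : ℝ) r).isPreconnected
      (fun y hy => (hder y hy).differentiableAt.differentiableWithinAt)
      (fun y hy => (Real.hasDerivAt_arcsin (hball y hy).1
        (hball y hy).2).differentiableAt.differentiableWithinAt) ?_ (Metric.mem_ball_self hr0) ?_
    · intro y hy
      rw [(hder y hy).deriv, (Real.hasDerivAt_arcsin (hball y hy).1 (hball y hy).2).deriv]
    · simp
  have hmem : u ∈ Metric.ball (0 : ℝ) r := by simpa using hur
  rw [← heq hmem]
  refine Summable.hasSum ?_
  refine Summable.of_norm_bounded hsum fun k => ?_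
  rw [norm_mul, norm_pow, Real.norm_of_nonneg (arcsinCoeff_pos k).le, Real.norm_eq_abs, ← pow_mul]
  have h1 : arcsinCoeff k ≤ invSqrtCoeff k :=
    div_le_self (invSqrtCoeff_pos k).le (by linarith [k.cast_nonneg (α := ℝ)])
  have h2 : |u| ^ (2 * k + 1) ≤ r ^ (2 * k) := by
    rw [pow_succ]
    calc |u| ^ (2 * k) * |u| ≤ |u| ^ (2 * k) * 1 := by gcongr
      _ ≤ r ^ (2 * k) := by rw [mul_one]; gcongr
  exact mul_le_mul h1 h2 (by positivity) (invSqrtCoeff_pos k).le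

/-- The terms are positive, so for `0 < u < 1` each partial sum at `u` is at most `arcsin u ≤ π/2`;
let `u → 1`. -/
theorem summable_arcsinCoeff : Summable arcsinCoeff := by
  refine summable_of_sum_le (c := Real.pi / 2) (fun k => (arcsinCoeff_pos k).le) fun s => ?_
  have hlim : Tendsto (fun u : ℝ => ∑ k ∈ s, arcsinCoeff k * u ^ (2 * k + 1)) (𝓝[<] 1)
      (𝓝 (∑ k ∈ s, arcsinCoeff k * 1 ^ (2 * k + 1))) := by
    refine (Continuous.tendsto ?_ 1).mono_left nhdsWithin_le_nhds
    fun_prop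
  simp only [one_pow, mul_one] at hlim
  refine le_of_tendsto hlim ?_
  filter_upwards [Ioo_mem_nhdsLT (zero_lt_one' ℝ)] with u hu
  have habs : |u| < 1 := by rw [abs_of_pos hu.1]; exact hu.2
  refine (sum_le_hasSum s (fun k _ => ?_) (hasSum_arcsin_of_lt habs)).trans
    (Real.arcsin_le_pi_div_two u)
  exact mul_nonneg (arcsinCoeff_pos k).le (pow_nonneg hu.1.le _)

/-- The endpoints matter: inner products on the sphere reach `±1`, and the value at `1` enters the
comparison of `β₀` with `β₁`. Uniform convergence makes the sum continuous on `[-1, 1]`, so the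
identity extends from the open interval. -/
theorem hasSum_arcsin {u : ℝ} (hu : |u| ≤ 1) :
    HasSum (fun k => arcsinCoeff k * u ^ (2 * k + 1)) (Real.arcsin u) := by
  have hbound : ∀ k, ∀ y ∈ Set.Icc (-1 : ℝ) 1,
      ‖arcsinCoeff k * y ^ (2 * k + 1)‖ ≤ arcsinCoeff k := by
    intro k y hy
    rw [norm_mul, norm_pow, Real.norm_of_nonneg (arcsinCoeff_pos k).le]
    exact mul_le_of_le_one_right (arcsinCoeff_pos k).le
      (pow_le_one₀ (norm_nonneg _) (abs_le.2 hy))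
  have hcont : ContinuousOn (fun y => ∑' k, arcsinCoeff k * y ^ (2 * k + 1)) (Set.Icc (-1 : ℝ) 1) :=
    continuousOn_tsum (fun k => by fun_prop) summable_arcsinCoeff hbound
  have hmem : u ∈ Set.Icc (-1 : ℝ) 1 := abs_le.1 hu
  have heq : Set.EqOn (fun y => ∑' k, arcsinCoeff k * y ^ (2 * k + 1)) Real.arcsin
      (Set.Icc (-1 : ℝ) 1) := by
    have h1 : Set.EqOn (fun y => ∑' k, arcsinCoeff k * y ^ (2 * k + 1)) Real.arcsin
        (Set.Ioo (-1 : ℝ) 1) := fun y hy => (hasSum_arcsin_of_lt (abs_lt.2 hy)).tsum_eq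
    refine h1.of_subset_closure hcont Real.continuous_arcsin.continuousOn Set.Ioo_subset_Icc_self ?_
    rw [closure_Ioo (by norm_num)]
  rw [← heq hmem]
  exact (Summable.of_norm_bounded summable_arcsinCoeff fun k => hbound k u hmem).hasSum

theorem iteratedDeriv_zero_of_hasSum {a : ℕ → ℝ} {f : ℝ → ℝ}
    (h : ∀ u, |u| < 1 → HasSum (fun n => a n * u ^ n) (f u)) (n : ℕ) :
    iteratedDeriv n f 0 = n.factorial * a n := by
  have h1 : HasFPowerSeriesAt f (FormalMultilinearSeries.ofScalars ℝ a) 0 := by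
    rw [hasFPowerSeriesAt_iff]
    filter_upwards [Metric.ball_mem_nhds (0 : ℝ) one_pos] with u hu
    rw [zero_add]
    refine (h u (by simpa using hu)).congr_fun fun n => ?_
    rw [FormalMultilinearSeries.coeff_ofScalars, smul_eq_mul, mul_comm]
  have h2 := h1.analyticAt.hasFPowerSeriesAt
  have h3 := congrArg (fun p => p.coeff n) (h1.eq_formalMultilinearSeries h2)
  simp only [FormalMultilinearSeries.coeff_ofScalars] at h3
  rw [h3]
  field_simp

/-- The power series coefficients of `profile`. -/
def profileCoeff (n : ℕ) : ℝ :=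
  (if n = 1 then 1 / 4 else 0) +
    Function.extend (fun k : ℕ => 2 * k + 2) (fun k => arcsinCoeff k / (2 * Real.pi)) 0 n

theorem injective_two_mul_add_two : Function.Injective (fun k : ℕ => 2 * k + 2) := by
  intro a b h
  simpa using h

theorem profileCoeff_even (k : ℕ) :
    profileCoeff (2 * k + 2) = arcsinCoeff k / (2 * Real.pi) := by
  rw [profileCoeff, if_neg (by omega), zero_add]
  exact injective_two_mul_add_two.extend_apply _ _ k

theorem profileCoeff_of_forall_ne {n : ℕ} (h : ∀ k : ℕ, 2 * k + 2 ≠ n) :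
    profileCoeff n = if n = 1 then 1 / 4 else 0 := by
  rw [profileCoeff, Function.extend_apply' _ _ _ (by rintro ⟨k, hk⟩; exact h k hk)]
  simp

theorem profileCoeff_one : profileCoeff 1 = 1 / 4 := by
  rw [profileCoeff_of_forall_ne (by omega), if_pos rfl]

theorem profileCoeff_odd (k : ℕ) : profileCoeff (2 * k + 3) = 0 := by
  rw [profileCoeff_of_forall_ne (by omega), if_neg (by omega)]

theorem profileCoeff_even_pos (k : ℕ) : 0 < profileCoeff (2 * k + 2) := by
  rw [profileCoeff_even]
  have := arcsinCoeff_pos k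
  positivity

theorem profileCoeff_nonneg (n : ℕ) : 0 ≤ profileCoeff n := by
  by_cases h : ∃ k : ℕ, 2 * k + 2 = n
  · obtain ⟨k, rfl⟩ := h
    exact (profileCoeff_even_pos k).le
  · rw [profileCoeff_of_forall_ne (by simpa using h)]
    split_ifs <;> norm_num

theorem hasSum_profile {u : ℝ} (hu : |u| ≤ 1) :
    HasSum (fun n => profileCoeff n * u ^ n) (profile u) := by
  have h1 : HasSum (fun n : ℕ => (if n = 1 then (1 / 4 : ℝ) * u else 0)) (1 / 4 * u) :=
    hasSum_ite_eq 1 _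
  have h2 := (hasSum_extend_zero injective_two_mul_add_two).2
    ((hasSum_arcsin hu).mul_left (u / (2 * Real.pi)))
  have h3 : profile u = 1 / 4 * u + u / (2 * Real.pi) * Real.arcsin u := by
    rw [profile, Real.arccos]
    field_simp
    ring
  rw [h3]
  refine (h1.add h2).congr_fun fun n => ?_
  by_cases h : ∃ k : ℕ, 2 * k + 2 = n
  · obtain ⟨k, rfl⟩ := h
    rw [profileCoeff_even, if_neg (by omega),
      injective_two_mul_add_two.extend_apply (fun k => u / (2 * Real.pi) * _) _ k]
    ring
  · rw [profileCoeff_of_forall_ne (by simpa using h),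
      Function.extend_apply' _ _ _ (by simpa using h)]
    by_cases hn : n = 1 <;> simp [hn]

theorem summable_profileCoeff : Summable profileCoeff := by
  simpa using (hasSum_profile (u := 1) (by simp)).summable

theorem iteratedDeriv_profile (n : ℕ) : iteratedDeriv n profile 0 = n.factorial * profileCoeff n :=
  iteratedDeriv_zero_of_hasSum (fun _ hu => hasSum_profile hu.le) n

/-! ### Gaussian integrals of polynomials -/

section GaussianMoments

theorem integrable_pow_mul_exp_neg_sq (a : ℕ) :
    Integrable (fun t : ℝ => t ^ a * Real.exp (-t ^ 2 / 2)) := by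
  have h := integrable_rpow_mul_exp_neg_mul_sq (b := 1 / 2) (by norm_num) (s := a)
    (by linarith [a.cast_nonneg (α := ℝ)])
  refine h.congr (Eventually.of_forall fun t => ?_)
  simp only [Real.rpow_natCast]
  congr 2
  ring

/-- The (unnormalized) moments of the standard Gaussian on `ℝ`. -/
def gaussMoment (a : ℕ) : ℝ := ∫ t : ℝ, t ^ a * Real.exp (-t ^ 2 / 2)

/-- The derivative of `tᵃ exp(-t²/2)` has integral zero. For `a = 0` the truncated index `a - 1` is
harmless, its coefficient being `0`. -/
theorem gaussMoment_succ (a : ℕ) : gaussMoment (a + 1) = a * gaussMoment (a - 1) := by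
  have hd : ∀ t : ℝ, HasDerivAt (fun t : ℝ => t ^ a * Real.exp (-t ^ 2 / 2))
      (a * (t ^ (a - 1) * Real.exp (-t ^ 2 / 2)) - t ^ (a + 1) * Real.exp (-t ^ 2 / 2)) t := by
    intro t
    have h1 : HasDerivAt (fun t : ℝ => -t ^ 2 / 2) (-t) t :=
      ((hasDerivAt_pow 2 t).neg.div_const 2).congr_deriv (by push_cast; ring)
    exact ((hasDerivAt_pow a t).mul h1.exp).congr_deriv (by ring)
  have h1 := (integrable_pow_mul_exp_neg_sq (a - 1)).const_mul (a : ℝ)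
  have h2 := integrable_pow_mul_exp_neg_sq (a + 1)
  have h := integral_eq_zero_of_hasDerivAt_of_integrable hd (h1.sub h2)
    (integrable_pow_mul_exp_neg_sq a)
  rw [integral_sub h1 h2, integral_const_mul] at h
  rw [gaussMoment, gaussMoment]
  linarith

theorem gaussian_monomial (d : ℕ) (s : Fin d →₀ ℕ) (c : ℝ) (x : EuclideanSpace ℝ (Fin d)) :
    MvPolynomial.eval (fun i => x i) (MvPolynomial.monomial s c) * Real.exp (-‖x‖ ^ 2 / 2) =
      c * ∏ i, (x i ^ s i * Real.exp (-x i ^ 2 / 2)) := by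
  rw [Finset.prod_mul_distrib, ← Real.exp_sum, EuclideanSpace.real_norm_sq_eq,
    MvPolynomial.eval_monomial, Finsupp.prod_fintype _ _ (by simp), ← Finset.sum_div,
    Finset.sum_neg_distrib, mul_assoc]

theorem integral_gaussian_monomial (d : ℕ) (s : Fin d →₀ ℕ) (c : ℝ) :
    ∫ x : EuclideanSpace ℝ (Fin d), MvPolynomial.eval (fun i => x i) (MvPolynomial.monomial s c) *
      Real.exp (-‖x‖ ^ 2 / 2) = c * ∏ i, gaussMoment (s i) := by
  simp_rw [gaussian_monomial]
  rw [integral_const_mul, ← (PiLp.volume_preserving_toLp (Fin d)).integral_comp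
    (MeasurableEquiv.toLp 2 (Fin d → ℝ)).measurableEmbedding]
  congr 1
  exact integral_fintype_prod_volume_eq_prod
    (f := fun i (t : ℝ) => t ^ s i * Real.exp (-t ^ 2 / 2))

theorem integrable_gaussian (d : ℕ) (P : MvPolynomial (Fin d) ℝ) :
    Integrable (fun x : EuclideanSpace ℝ (Fin d) =>
      MvPolynomial.eval (fun i => x i) P * Real.exp (-‖x‖ ^ 2 / 2)) := by
  induction P using MvPolynomial.induction_on' with
  | monomial s c =>
    simp_rw [gaussian_monomial]
    rw [← (PiLp.volume_preserving_toLp (Fin d)).integrable_comp_emb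
      (MeasurableEquiv.toLp 2 (Fin d → ℝ)).measurableEmbedding]
    exact (Integrable.fintype_prod (f := fun i (t : ℝ) => t ^ s i * Real.exp (-t ^ 2 / 2))
      fun i => integrable_pow_mul_exp_neg_sq (s i)).const_mul c
  | add p q hp hq =>
    simp only [map_add, add_mul]
    exact hp.add hq

/-- The (unnormalized) Gaussian integral of a polynomial. -/
def gaussInt (d : ℕ) : MvPolynomial (Fin d) ℝ →ₗ[ℝ] ℝ where
  toFun P := ∫ x : EuclideanSpace ℝ (Fin d),
    MvPolynomial.eval (fun i => x i) P * Real.exp (-‖x‖ ^ 2 / 2)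
  map_add' P Q := by
    simp only [map_add, add_mul]
    exact integral_add (integrable_gaussian d P) (integrable_gaussian d Q)
  map_smul' c P := by
    simp only [MvPolynomial.smul_eval, mul_assoc, integral_const_mul, RingHom.id_apply,
      smul_eq_mul]

theorem gaussInt_monomial (d : ℕ) (s : Fin d →₀ ℕ) (c : ℝ) :
    gaussInt d (MvPolynomial.monomial s c) = c * ∏ i, gaussMoment (s i) :=
  integral_gaussian_monomial d s c

theorem gaussInt_X_mul (d : ℕ) (i : Fin d) (P : MvPolynomial (Fin d) ℝ) :
    gaussInt d (MvPolynomial.X i * P) = gaussInt d (MvPolynomial.pderiv i P) := by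
  induction P using MvPolynomial.induction_on' with
  | monomial s c =>
    rw [MvPolynomial.pderiv_monomial, mul_comm, ← pow_one (MvPolynomial.X i),
      ← MvPolynomial.monomial_add_single, gaussInt_monomial, gaussInt_monomial,
      ← Finset.mul_prod_erase _ _ (Finset.mem_univ i),
      ← Finset.mul_prod_erase _ _ (Finset.mem_univ i)]
    have h : ∀ f : Fin d →₀ ℕ, (∀ j, j ≠ i → f j = s j) →
        ∏ j ∈ Finset.univ.erase i, gaussMoment (f j) =
          ∏ j ∈ Finset.univ.erase i, gaussMoment (s j) :=
      fun f hf => Finset.prod_congr rfl fun j hj => by rw [hf j (Finset.ne_of_mem_erase hj)]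
    rw [h (s + Finsupp.single i 1) fun j hj => by simp [hj.symm],
      h (s - Finsupp.single i 1) fun j hj => by simp [hj.symm]]
    simp only [Finsupp.add_apply, Finsupp.tsub_apply, Finsupp.single_eq_same, gaussMoment_succ]
    ring
  | add p q hp hq => rw [mul_add, map_add, map_add, map_add, hp, hq]

theorem polyLaplacian_apply (d : ℕ) (P : MvPolynomial (Fin d) ℝ) :
    polyLaplacian d P = ∑ i, MvPolynomial.pderiv i (MvPolynomial.pderiv i P) := by
  simp [polyLaplacian]

/-- Integration by parts turns each `∂ᵢ(∂ᵢP)` into `xᵢ ∂ᵢP`; Euler's identity sums these to `nP`. -/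
theorem gaussInt_laplacian {d n : ℕ} {P : MvPolynomial (Fin d) ℝ} (hP : P.IsHomogeneous n) :
    gaussInt d (polyLaplacian d P) = n * gaussInt d P := by
  rw [polyLaplacian_apply, map_sum, ← nsmul_eq_mul, ← map_nsmul, ← hP.sum_X_mul_pderiv, map_sum]
  exact Finset.sum_congr rfl fun i _ => (gaussInt_X_mul d i _).symm

end GaussianMoments

/-! ### Polar coordinates -/

section Polar

/-- The radial Gaussian moments. -/
def radialMoment (k : ℕ) : ℝ := ∫ r in Set.Ioi (0 : ℝ), r ^ k * Real.exp (-r ^ 2 / 2)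

theorem radialMoment_eq (k : ℕ) :
    radialMoment k = (1 / 2 : ℝ) ^ (-((k : ℝ) + 1) / 2) * (1 / 2) * Real.Gamma ((k + 1) / 2) := by
  have h := integral_rpow_mul_exp_neg_mul_rpow (p := 2) (q := k) (b := 1 / 2) (by norm_num)
    (by linarith [k.cast_nonneg (α := ℝ)]) (by norm_num)
  rw [radialMoment, ← h]
  refine setIntegral_congr_fun measurableSet_Ioi fun r _ => ?_
  simp only [Real.rpow_natCast, Real.rpow_two]
  congr 2
  ring

theorem radialMoment_pos (k : ℕ) : 0 < radialMoment k := by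
  rw [radialMoment_eq]
  have := Real.Gamma_pos_of_pos (s := ((k : ℝ) + 1) / 2) (by positivity)
  positivity

theorem radialMoment_add_two (k : ℕ) : radialMoment (k + 2) = (k + 1) * radialMoment k := by
  rw [radialMoment_eq, radialMoment_eq]
  have h1 : (((k + 2 : ℕ) : ℝ) + 1) / 2 = ((k : ℝ) + 1) / 2 + 1 := by push_cast; ring
  have h2 : -(((k + 2 : ℕ) : ℝ) + 1) / 2 = -((k : ℝ) + 1) / 2 + (-1) := by push_cast; ring
  rw [h1, h2, Real.Gamma_add_one (by positivity), Real.rpow_add (by norm_num), Real.rpow_neg_one]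
  ring

theorem eval_smul_of_isHomogeneous {d n : ℕ} {P : MvPolynomial (Fin d) ℝ}
    (hP : P.IsHomogeneous n) (r : ℝ) (x : Fin d → ℝ) :
    MvPolynomial.eval (fun i => r * x i) P = r ^ n * MvPolynomial.eval x P := by
  rw [MvPolynomial.eval_eq, MvPolynomial.eval_eq, Finset.mul_sum]
  refine Finset.sum_congr rfl fun s hs => ?_
  simp_rw [mul_pow]
  rw [Finset.prod_mul_distrib, Finset.prod_pow_eq_pow_sum]
  have h := hP (MvPolynomial.mem_support_iff.1 hs)
  rw [Finsupp.weight_apply, Finsupp.sum] at h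
  simp only [Pi.one_apply, smul_eq_mul, mul_one] at h
  rw [h]
  ring

theorem integral_volumeIoiPow (n : ℕ) (f : ℝ → ℝ) :
    ∫ r : Set.Ioi (0 : ℝ), f r ∂(Measure.volumeIoiPow n) =
      ∫ r in Set.Ioi (0 : ℝ), r ^ n * f r := by
  simp only [Measure.volumeIoiPow, ENNReal.ofReal]
  rw [integral_withDensity_eq_integral_smul
      ((measurable_subtype_coe.pow_const _).real_toNNReal),
    integral_subtype_comap measurableSet_Ioi fun a ↦ Real.toNNReal (a ^ n) • f a]
  refine setIntegral_congr_fun measurableSet_Ioi fun x hx ↦ ?_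
  simp only [NNReal.smul_def, Real.coe_toNNReal _ (pow_nonneg hx.out.le _), smul_eq_mul]

/-- Homogeneity contributes `rⁿ` and the volume element `r^(d-1)`, so the radial and angular
integrals separate. -/
theorem gaussInt_eq_radial {d n : ℕ} (hd : 1 ≤ d) {P : MvPolynomial (Fin d) ℝ}
    (hP : P.IsHomogeneous n) :
    gaussInt d P = radialMoment (n + (d - 1)) *
      ∫ x, restrictSphere d P x
        ∂(volume : Measure (EuclideanSpace ℝ (Fin d))).toSphere := by
  have : Nonempty (Fin d) := ⟨⟨0, hd⟩⟩
  let E := EuclideanSpace ℝ (Fin d)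
  let F : E → ℝ := fun x => MvPolynomial.eval (fun i => x i) P * Real.exp (-‖x‖ ^ 2 / 2)
  have hF : ∀ p : Sph d × Set.Ioi (0 : ℝ), F ((homeomorphUnitSphereProd E).symm p) =
      restrictSphere d P p.1 * ((p.2 : ℝ) ^ n * Real.exp (-(p.2 : ℝ) ^ 2 / 2)) := by
    intro p
    have h1 : ‖(((homeomorphUnitSphereProd E).symm p : ({0}ᶜ : Set E)) : E)‖ = (p.2 : ℝ) := by
      simp [norm_smul, abs_of_pos p.2.2.out]
    simp only [F]
    rw [h1, restrictSphere_apply]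
    rw [homeomorphUnitSphereProd_symm_apply_coe]
    change MvPolynomial.eval (fun i => (p.2 : ℝ) * (p.1 : E) i) P * _ = _
    rw [eval_smul_of_isHomogeneous hP]
    ring
  calc gaussInt d P = ∫ x : E, F x := rfl
    _ = ∫ x : ({(0)}ᶜ : Set E), F x ∂((volume : Measure E).comap (↑)) := by
      rw [integral_subtype_comap (measurableSet_singleton _).compl F,
        restrict_compl_singleton]
    _ = ∫ p, F ((homeomorphUnitSphereProd E).symm p) ∂(volume : Measure E).toSphere.prod
          (.volumeIoiPow (Module.finrank ℝ E - 1)) := by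
      rw [← (volume : Measure E).measurePreserving_homeomorphUnitSphereProd.integral_comp
        (Homeomorph.measurableEmbedding _)]
      simp
    _ = _ := by
      simp_rw [hF]
      rw [integral_prod_mul (fun x : Sph d => restrictSphere d P x)
        (fun r : Set.Ioi (0 : ℝ) => (r : ℝ) ^ n * Real.exp (-(r : ℝ) ^ 2 / 2)),
        integral_volumeIoiPow _ (fun r => r ^ n * Real.exp (-r ^ 2 / 2)), mul_comm,
        radialMoment, finrank_euclideanSpace_fin]
      congr 1
      refine integral_congr_ae (Eventually.of_forall fun r => ?_)
      simp only [pow_add]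
      ring

end Polar

/-! ### Mean of a Laplacian over the sphere -/

section SphereIntegral

theorem integrable_unif (d : ℕ) (f : C(Sph d, ℝ)) : Integrable f (unif d) :=
  f.continuous.integrable_of_hasCompactSupport (HasCompactSupport.of_compactSpace f)

/-- The mean of a polynomial over the sphere. -/
def sphereInt (d : ℕ) : MvPolynomial (Fin d) ℝ →ₗ[ℝ] ℝ where
  toFun P := ∫ x, restrictSphere d P x ∂(unif d)
  map_add' P Q := by
    simp only [map_add, ContinuousMap.add_apply]
    exact integral_add (integrable_unif d _) (integrable_unif d _)
  map_smul' c P := by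
    simp only [map_smul, ContinuousMap.smul_apply, smul_eq_mul, integral_const_mul,
      RingHom.id_apply]

theorem pderiv_of_isHomogeneous_zero {d : ℕ} {P : MvPolynomial (Fin d) ℝ}
    (hP : P.IsHomogeneous 0) (i : Fin d) : MvPolynomial.pderiv i P = 0 := by
  rw [MvPolynomial.totalDegree_eq_zero_iff_eq_C.1 (Nat.le_zero.1 hP.totalDegree_le)]
  exact MvPolynomial.pderiv_C

theorem isHomogeneous_laplacian {d n : ℕ} {P : MvPolynomial (Fin d) ℝ}
    (hP : P.IsHomogeneous n) : (polyLaplacian d P).IsHomogeneous (n - 2) := by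
  rw [polyLaplacian_apply]
  exact MvPolynomial.IsHomogeneous.sum _ _ _ fun i _ => hP.pderiv.pderiv

theorem laplacian_of_isHomogeneous_lt {d n : ℕ} {P : MvPolynomial (Fin d) ℝ}
    (hP : P.IsHomogeneous n) (hn : n < 2) : polyLaplacian d P = 0 := by
  rw [polyLaplacian_apply]
  refine Finset.sum_eq_zero fun i _ => pderiv_of_isHomogeneous_zero ?_ i
  have h := hP.pderiv (i := i)
  rwa [show n - 1 = 0 by omega] at h

/-- The mean over the sphere of the Laplacian of a homogeneous polynomial. -/
theorem sphereInt_laplacian {d n : ℕ} (hd : 2 ≤ d) {P : MvPolynomial (Fin d) ℝ}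
    (hP : P.IsHomogeneous n) :
    sphereInt d (polyLaplacian d P) = n * (n + d - 2) * sphereInt d P := by
  have hs : ∀ Q : MvPolynomial (Fin d) ℝ, sphereInt d Q =
      ((volume : Measure (EuclideanSpace ℝ (Fin d))).toSphere Set.univ)⁻¹.toReal *
      ∫ x, restrictSphere d Q x ∂(volume : Measure (EuclideanSpace ℝ (Fin d))).toSphere := by
    intro Q
    change ∫ x, restrictSphere d Q x ∂(unif d) = _
    rw [unif, integral_smul_measure, smul_eq_mul]
  have hg := gaussInt_laplacian hP
  rw [hs, hs]
  rw [gaussInt_eq_radial (by omega) hP] at hg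
  have hne := (radialMoment_pos (n - 2 + (d - 1))).ne'
  -- Below degree 2 the Laplacian vanishes, which forces `n = 0` or a zero mean. Otherwise the
  -- radial moments for `P` and `ΔP` differ by the factor `n + d - 2`, and the common one cancels.
  rcases lt_or_ge n 2 with hn | hn
  · have h0 := laplacian_of_isHomogeneous_lt hP hn
    rw [h0] at hg ⊢
    have hne := (radialMoment_pos (n + (d - 1))).ne'
    rw [map_zero, zero_eq_mul, mul_eq_zero_iff_left hne, Nat.cast_eq_zero] at hg
    rcases hg with rfl | hg
    · simp
    · rw [hg]
      simp
  · rw [gaussInt_eq_radial (by omega) (isHomogeneous_laplacian hP),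
      show n + (d - 1) = n - 2 + (d - 1) + 2 by omega, radialMoment_add_two] at hg
    have hcast : ((n - 2 + (d - 1) : ℕ) : ℝ) + 1 = n + d - 2 := by
      rw [Nat.cast_add, Nat.cast_sub hn, Nat.cast_sub (by omega : 1 ≤ d)]
      push_cast
      ring
    rw [hcast] at hg
    have h2 := mul_left_cancel₀ hne (hg.trans (by ring :
      _ = radialMoment (n - 2 + (d - 1)) * (n * (n + d - 2) *
        ∫ x, restrictSphere d P x ∂(volume : Measure (EuclideanSpace ℝ (Fin d))).toSphere)))
    rw [h2]
    ring

end SphereIntegral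

/-! ### Laplacian and partial derivatives -/

section Algebra

variable {d : ℕ}

/-- The commutator of two derivations is a derivation, and this one kills every variable. -/
theorem pderiv_comm (i j : Fin d) (P : MvPolynomial (Fin d) ℝ) :
    MvPolynomial.pderiv i (MvPolynomial.pderiv j P) =
      MvPolynomial.pderiv j (MvPolynomial.pderiv i P) := by
  have h : ⁅MvPolynomial.pderiv (R := ℝ) i, MvPolynomial.pderiv (R := ℝ) j⁆ = 0 := by
    refine MvPolynomial.derivation_ext fun k => ?_
    rw [Derivation.commutator_apply, MvPolynomial.pderiv_X, MvPolynomial.pderiv_X,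
      Pi.single_apply, Pi.single_apply]
    split_ifs <;> simp
  have h2 := DFunLike.congr_fun h P
  simp only [Derivation.commutator_apply, Derivation.zero_apply] at h2
  exact sub_eq_zero.1 h2

theorem laplacian_pderiv (i : Fin d) (P : MvPolynomial (Fin d) ℝ) :
    polyLaplacian d (MvPolynomial.pderiv i P) = MvPolynomial.pderiv i (polyLaplacian d P) := by
  rw [polyLaplacian_apply, polyLaplacian_apply, map_sum]
  refine Finset.sum_congr rfl fun j _ => ?_
  rw [pderiv_comm j i P, pderiv_comm j i]

theorem laplacian_mul (P Q : MvPolynomial (Fin d) ℝ) :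
    polyLaplacian d (P * Q) = polyLaplacian d P * Q +
      2 * ∑ i, MvPolynomial.pderiv i P * MvPolynomial.pderiv i Q + P * polyLaplacian d Q := by
  simp only [polyLaplacian_apply, Finset.sum_mul, Finset.mul_sum, ← Finset.sum_add_distrib]
  refine Finset.sum_congr rfl fun i _ => ?_
  simp only [MvPolynomial.pderiv_mul, map_add]
  ring

theorem mem_harmonicPoly {ℓ : ℕ} {P : MvPolynomial (Fin d) ℝ} :
    P ∈ harmonicPoly d ℓ ↔ P.IsHomogeneous ℓ ∧ polyLaplacian d P = 0 := Iff.rfl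

theorem pderiv_mem_harmonicPoly {ℓ : ℕ} {P : MvPolynomial (Fin d) ℝ} (hP : P ∈ harmonicPoly d ℓ)
    (i : Fin d) : MvPolynomial.pderiv i P ∈ harmonicPoly d (ℓ - 1) := by
  rw [mem_harmonicPoly] at hP ⊢
  exact ⟨hP.1.pderiv, by rw [laplacian_pderiv, hP.2, map_zero]⟩

end Algebra

/-! ### Orthogonality to lower degrees -/

section Orthogonality

variable {d : ℕ}

theorem sphereInt_mul_of_harmonic (hd : 2 ≤ d) {ℓ m : ℕ} {H R : MvPolynomial (Fin d) ℝ}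
    (hH : H ∈ harmonicPoly d ℓ) (hR : R.IsHomogeneous m) :
    ((ℓ + m : ℕ) : ℝ) * (ℓ + m + d - 2) * sphereInt d (H * R) =
      2 * ∑ i, sphereInt d (MvPolynomial.pderiv i H * MvPolynomial.pderiv i R) +
        sphereInt d (H * polyLaplacian d R) := by
  have h := sphereInt_laplacian hd (hH.1.mul hR)
  rw [laplacian_mul, (mem_harmonicPoly.1 hH).2, zero_mul, zero_add, two_mul, map_add, map_add,
    map_sum, ← two_mul] at h
  rw [h]
  push_cast
  ring

/-- A harmonic polynomial is orthogonal to all homogeneous polynomials of lower degree. -/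
theorem sphereInt_harmonic_mul_eq_zero (hd : 2 ≤ d) (m : ℕ) :
    ∀ (ℓ : ℕ) (H R : MvPolynomial (Fin d) ℝ), H ∈ harmonicPoly d ℓ → R.IsHomogeneous m → m < ℓ →
      sphereInt d (H * R) = 0 := by
  induction m using Nat.strong_induction_on with
  | _ m ih =>
    intro ℓ H R hH hR hlt
    -- Both terms on the right have smaller `m`: the gradient term lowers both degrees by one, the
    -- Laplacian term lowers `m` by two. Each still has `m < ℓ`, so induction kills it, and the
    -- factor on the left is nonzero.
    have h := sphereInt_mul_of_harmonic hd hH hR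
    have hgrad : ∑ i, sphereInt d (MvPolynomial.pderiv i H * MvPolynomial.pderiv i R) = 0 := by
      refine Finset.sum_eq_zero fun i _ => ?_
      rcases Nat.eq_zero_or_pos m with rfl | hm
      · rw [pderiv_of_isHomogeneous_zero hR, mul_zero, map_zero]
      · exact ih (m - 1) (by omega) (ℓ - 1) _ _ (pderiv_mem_harmonicPoly hH i) hR.pderiv (by omega)
    have hlap : sphereInt d (H * polyLaplacian d R) = 0 := by
      rcases lt_or_ge m 2 with hm | hm
      · rw [laplacian_of_isHomogeneous_lt hR hm, mul_zero, map_zero]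
      · exact ih (m - 2) (by omega) ℓ _ _ hH (isHomogeneous_laplacian hR) (by omega)
    rw [hgrad, hlap, mul_zero, add_zero] at h
    have h1 : ((ℓ + m : ℕ) : ℝ) ≠ 0 := by
      rw [Nat.cast_ne_zero]
      omega
    have h2 : (ℓ + m + d - 2 : ℝ) ≠ 0 := by
      have h3 : (2 : ℝ) ≤ d := by exact_mod_cast hd
      have h4 : (0 : ℝ) < ℓ := by exact_mod_cast (by omega : 0 < ℓ)
      have h5 : (0 : ℝ) ≤ m := m.cast_nonneg
      exact ne_of_gt (by linarith)
    exact (mul_eq_zero.1 h).resolve_left (mul_ne_zero h1 h2)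

theorem sphereInt_harmonic_mul_harmonic (hd : 2 ≤ d) {ℓ m : ℕ} (hne : ℓ ≠ m)
    {H R : MvPolynomial (Fin d) ℝ} (hH : H ∈ harmonicPoly d ℓ) (hR : R ∈ harmonicPoly d m) :
    sphereInt d (H * R) = 0 := by
  rcases lt_or_gt_of_ne hne with h | h
  · rw [mul_comm]
    exact sphereInt_harmonic_mul_eq_zero hd ℓ m R H hR hH.1 h
  · exact sphereInt_harmonic_mul_eq_zero hd m ℓ H R hH hR.1 h

/-- The Laplacian preserves the parity of the degree, so the recursion descends to degree 1, where
the Laplacian is zero. -/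
theorem sphereInt_eq_zero_of_odd (hd : 2 ≤ d) (n : ℕ) :
    ∀ P : MvPolynomial (Fin d) ℝ, P.IsHomogeneous n → Odd n → sphereInt d P = 0 := by
  induction n using Nat.strong_induction_on with
  | _ n ih =>
    intro P hP hn
    have h := sphereInt_laplacian hd hP
    have hpos : 0 < n := hn.pos
    have hlap : sphereInt d (polyLaplacian d P) = 0 := by
      rcases lt_or_ge n 2 with h2 | h2
      · rw [laplacian_of_isHomogeneous_lt hP h2, map_zero]
      · exact ih (n - 2) (by omega) _ (isHomogeneous_laplacian hP)
          (Nat.Odd.sub_even h2 hn even_two)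
    rw [hlap] at h
    have h3 : (2 : ℝ) ≤ d := by exact_mod_cast hd
    have h4 : (0 : ℝ) < n := by exact_mod_cast hpos
    have h5 : (0 : ℝ) < n + d - 2 := by linarith
    exact (mul_eq_zero.1 h.symm).resolve_left (mul_pos h4 h5).ne'

end Orthogonality

/-! ### Restriction of polynomials to the sphere -/

section Restriction

variable {d : ℕ}

instance unif_isOpenPosMeasure (d : ℕ) : (unif d).IsOpenPosMeasure :=
  Measure.IsOpenPosMeasure.mk fun U hU hne => by
    rw [unif, Measure.smul_apply, smul_eq_mul]
    exact mul_ne_zero (ENNReal.inv_ne_zero.2 (measure_ne_top _ _)) (hU.measure_ne_zero _ hne)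

theorem restrictSphere_mul (P Q : MvPolynomial (Fin d) ℝ) :
    restrictSphere d (P * Q) = restrictSphere d P * restrictSphere d Q := by
  simp [restrictSphere]

/-- Scaling carries the vanishing from the sphere to all `x ≠ 0`; the origin follows by continuity.
-/
theorem eq_zero_of_restrictSphere_eq_zero (hd : 1 ≤ d) {n : ℕ} {P : MvPolynomial (Fin d) ℝ}
    (hP : P.IsHomogeneous n) (h : restrictSphere d P = 0) : P = 0 := by
  have hne : ∀ x : EuclideanSpace ℝ (Fin d), x ≠ 0 →
      MvPolynomial.eval (fun i => x i) P = 0 := by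
    intro x hx
    have hx0 : ‖x‖ ≠ 0 := norm_ne_zero_iff.2 hx
    let y : Sph d := ⟨‖x‖⁻¹ • x, by simp [norm_smul, hx0]⟩
    have hy : MvPolynomial.eval (fun i => (y : EuclideanSpace ℝ (Fin d)) i) P = 0 := by
      rw [← restrictSphere_apply, h, ContinuousMap.zero_apply]
    have h2 := eval_smul_of_isHomogeneous hP ‖x‖ (fun i => (y : EuclideanSpace ℝ (Fin d)) i)
    rw [hy, mul_zero] at h2
    rw [← h2]
    congr 2
    funext i
    simp [y, hx0]
  have hcont : Continuous fun x : EuclideanSpace ℝ (Fin d) =>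
      MvPolynomial.eval (fun i => x i) P :=
    (MvPolynomial.continuous_eval P).comp (by fun_prop)
  have : Nonempty (Fin d) := ⟨⟨0, hd⟩⟩
  have hall : (fun x : EuclideanSpace ℝ (Fin d) => MvPolynomial.eval (fun i => x i) P) = 0 :=
    hcont.ext_on (dense_compl_singleton (0 : EuclideanSpace ℝ (Fin d))) continuous_const
      fun x hx => hne x hx
  refine MvPolynomial.funext fun x => ?_
  simpa using congrFun hall (WithLp.toLp 2 x)

theorem restrictSphere_eq_zero_of_sphereInt_sq {P : MvPolynomial (Fin d) ℝ}
    (h : sphereInt d (P * P) = 0) : restrictSphere d P = 0 := by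
  have h1 : ∫ x, (restrictSphere d P x) ^ 2 ∂(unif d) = 0 := by
    rw [← h]
    change _ = ∫ x, restrictSphere d (P * P) x ∂(unif d)
    simp only [restrictSphere_mul, ContinuousMap.mul_apply, pow_two]
  have hcont : Continuous fun x => (restrictSphere d P x) ^ 2 := by fun_prop
  rw [integral_eq_zero_iff_of_nonneg (fun x => sq_nonneg _)
    (integrable_unif d ⟨_, hcont⟩), Continuous.ae_eq_iff_eq _ hcont continuous_zero] at h1
  ext x
  simpa using congrFun h1 x

/-- The polynomial `|x|²`. -/
def normSq (d : ℕ) : MvPolynomial (Fin d) ℝ := ∑ i, MvPolynomial.X i ^ 2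

theorem isHomogeneous_normSq (d : ℕ) : (normSq d).IsHomogeneous 2 :=
  MvPolynomial.IsHomogeneous.sum _ _ _ fun i _ => by
    simpa using (MvPolynomial.isHomogeneous_X ℝ i).pow 2

theorem restrictSphere_normSq (d : ℕ) : restrictSphere d (normSq d) = 1 := by
  ext x
  have h : ‖(x : EuclideanSpace ℝ (Fin d))‖ ^ 2 = 1 := by simp
  rw [EuclideanSpace.real_norm_sq_eq] at h
  rw [restrictSphere_apply, normSq, map_sum, ContinuousMap.one_apply]
  simpa using h

end Restriction

/-! ### Harmonic decomposition and completeness -/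

section Decomposition

variable {d : ℕ}

instance finite_homogeneousSubmodule (d n : ℕ) :
    Module.Finite ℝ (MvPolynomial.homogeneousSubmodule (Fin d) ℝ n) :=
  Module.Finite.iff_fg.2 (MvPolynomial.homogeneousSubmodule_fg (Fin d) ℝ n)

/-- The Laplacian from homogeneous polynomials of degree `n + 2` to those of degree `n`. -/
def laplacianHom (d n : ℕ) : MvPolynomial.homogeneousSubmodule (Fin d) ℝ (n + 2) →ₗ[ℝ]
    MvPolynomial.homogeneousSubmodule (Fin d) ℝ n :=
  (polyLaplacian d).restrict fun _ hP => isHomogeneous_laplacian hP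

/-- Multiplication by `|x|²` on homogeneous polynomials. -/
def mulNormSq (d n : ℕ) : MvPolynomial.homogeneousSubmodule (Fin d) ℝ n →ₗ[ℝ]
    MvPolynomial.homogeneousSubmodule (Fin d) ℝ (n + 2) :=
  (LinearMap.mulLeft ℝ (normSq d)).restrict fun P hP => by
    have h := (isHomogeneous_normSq d).mul hP
    rwa [add_comm] at h

/-- If `|x|² Q` is harmonic, it is orthogonal to `Q`, which has lower degree. Since `|x|² = 1` on
the sphere, `Q²` has mean zero and `Q = 0`. An injective endomorphism in finite dimension is
surjective. -/
theorem bijective_laplacian_mulNormSq (hd : 2 ≤ d) (n : ℕ) :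
    Function.Bijective (laplacianHom d n ∘ₗ mulNormSq d n) := by
  have hinj : Function.Injective (laplacianHom d n ∘ₗ mulNormSq d n) := by
    rw [← LinearMap.ker_eq_bot, LinearMap.ker_eq_bot']
    intro Q hQ
    have hharm : normSq d * (Q : MvPolynomial (Fin d) ℝ) ∈ harmonicPoly d (n + 2) :=
      ⟨(mulNormSq d n Q).2, congrArg Subtype.val hQ⟩
    have h := sphereInt_harmonic_mul_eq_zero hd n (n + 2) _ Q hharm Q.2 (by omega)
    have h2 : sphereInt d ((Q : MvPolynomial (Fin d) ℝ) * Q) = 0 := by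
      rw [← h]
      change ∫ x, restrictSphere d _ x ∂(unif d) = ∫ x, restrictSphere d _ x ∂(unif d)
      rw [restrictSphere_mul, restrictSphere_mul, restrictSphere_mul, restrictSphere_normSq,
        one_mul]
    exact Subtype.ext (eq_zero_of_restrictSphere_eq_zero (by omega) Q.2
      (restrictSphere_eq_zero_of_sphereInt_sq h2))
  exact ⟨hinj, LinearMap.injective_iff_surjective.1 hinj⟩

theorem surjective_laplacianHom (hd : 2 ≤ d) (n : ℕ) :
    Function.Surjective (laplacianHom d n) := by
  have h := (bijective_laplacian_mulNormSq hd n).2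
  rw [LinearMap.coe_comp] at h
  exact h.of_comp

/-- Solve `Δ(|x|² Q) = ΔP` for `Q`; the remainder `P - |x|² Q` is harmonic. -/
theorem exists_harmonic_add_normSq_mul (hd : 2 ≤ d) {n : ℕ} {P : MvPolynomial (Fin d) ℝ}
    (hP : P.IsHomogeneous (n + 2)) : ∃ H ∈ harmonicPoly d (n + 2),
      ∃ Q : MvPolynomial (Fin d) ℝ, Q.IsHomogeneous n ∧ P = H + normSq d * Q := by
  obtain ⟨Q, hQ⟩ := (bijective_laplacian_mulNormSq hd n).2 (laplacianHom d n ⟨P, hP⟩)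
  have h1 := congrArg Subtype.val hQ
  change polyLaplacian d (normSq d * Q) = polyLaplacian d P at h1
  refine ⟨P - normSq d * Q, ⟨?_, ?_⟩, Q, Q.2, by ring⟩
  · exact MvPolynomial.IsHomogeneous.sub hP (mulNormSq d n Q).2
  · change polyLaplacian d (P - normSq d * Q) = 0
    rw [map_sub, h1, sub_self]

/-- The restriction to the sphere of a homogeneous polynomial is a sum of spherical harmonics. -/
theorem restrictSphere_mem_iSup (hd : 2 ≤ d) (n : ℕ) :
    ∀ P : MvPolynomial (Fin d) ℝ, P.IsHomogeneous n →
      restrictSphere d P ∈ ⨆ ℓ : ℕ, (harmonicPoly d ℓ).map (restrictSphere d) := by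
  induction n using Nat.strong_induction_on with
  | _ n ih =>
    intro P hP
    rcases lt_or_ge n 2 with hn | hn
    · exact Submodule.mem_iSup_of_mem n
        ⟨P, ⟨hP, laplacian_of_isHomogeneous_lt hP hn⟩, rfl⟩
    · obtain ⟨k, rfl⟩ := Nat.exists_eq_add_of_le' hn
      obtain ⟨H, hH, Q, hQ, rfl⟩ := exists_harmonic_add_normSq_mul hd hP
      rw [map_add, restrictSphere_mul, restrictSphere_normSq, one_mul]
      exact Submodule.add_mem _ (Submodule.mem_iSup_of_mem (k + 2) ⟨H, hH, rfl⟩)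
        (ih k (by omega) Q hQ)

theorem range_restrictSphere_le (hd : 2 ≤ d) :
    LinearMap.range (restrictSphere d) ≤
      ⨆ ℓ : ℕ, (harmonicPoly d ℓ).map (restrictSphere d) := by
  rintro _ ⟨P, rfl⟩
  rw [← P.sum_homogeneousComponent, map_sum]
  exact Submodule.sum_mem _ fun n _ => restrictSphere_mem_iSup hd n _
    (MvPolynomial.homogeneousComponent_isHomogeneous n P)

/-- Stone–Weierstrass: the coordinate functions separate points. -/
theorem dense_range_restrictSphere (d : ℕ) :
    (LinearMap.range (restrictSphere d)).topologicalClosure = ⊤ := by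
  have h := ContinuousMap.subalgebra_topologicalClosure_eq_top_of_separatesPoints
    (MvPolynomial.aeval (R := ℝ) (coord d)).range (by
      intro x y hxy
      have hne : ∃ i, (x : EuclideanSpace ℝ (Fin d)) i ≠ (y : EuclideanSpace ℝ (Fin d)) i := by
        by_contra hcon
        push Not at hcon
        exact hxy (Subtype.ext (PiLp.ext hcon))
      obtain ⟨i, hi⟩ := hne
      exact ⟨_, ⟨coord d i, ⟨MvPolynomial.X i, by simp⟩, rfl⟩, hi⟩)
  have h2 := congrArg (SetLike.coe (B := C(Sph d, ℝ))) h
  rw [Subalgebra.topologicalClosure_coe, AlgHom.coe_range] at h2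
  exact SetLike.ext' h2

theorem topologicalClosure_iSup_harmonics (hd : 2 ≤ d) :
    (⨆ ℓ : ℕ, harmonics d ℓ).topologicalClosure = ⊤ := by
  have h1 : (⨆ ℓ : ℕ, harmonics d ℓ) = (⨆ ℓ : ℕ, (harmonicPoly d ℓ).map (restrictSphere d)).map
      (ContinuousMap.toLp 2 (unif d) ℝ : C(Sph d, ℝ) →L[ℝ] L2 d).toLinearMap := by
    rw [Submodule.map_iSup]
    rfl
  have h2 := (ContinuousMap.toLp_denseRange ℝ (unif d) ℝ
    (by norm_num : (2 : ENNReal) ≠ ⊤)).topologicalClosure_map_submodule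
      (dense_range_restrictSphere d)
  rw [h1, eq_top_iff, ← h2]
  exact Submodule.topologicalClosure_mono (Submodule.map_mono (range_restrictSphere_le hd))

end Decomposition

/-! ### Recursions and inequalities for the Funk–Hecke coefficients -/

section FunkCoeff

theorem poch_succ (a : ℝ) (n : ℕ) : poch a (n + 1) = poch a n * (a + n) := by
  simp [poch, ascPochhammer_succ_eval]

theorem poch_zero (a : ℝ) : poch a 0 = 1 := by simp [poch]

theorem poch_pos {a : ℝ} (ha : 0 < a) (n : ℕ) : 0 < poch a n := ascPochhammer_pos n a ha

/-- The eigenvalue of the kernel `⟨x, y⟩ ^ (ℓ + 2 m)` on the spherical harmonics of degree `ℓ`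
in dimension `2 lam + 2`. -/
def funkCoeff (lam : ℝ) (ℓ m : ℕ) : ℝ :=
  lam * (ℓ + 2 * m).factorial / (2 ^ (ℓ + 2 * m) * m.factorial * poch lam (ℓ + m + 1))

variable {lam : ℝ}

theorem funkCoeff_pos (h : 0 < lam) (ℓ m : ℕ) : 0 < funkCoeff lam ℓ m := by
  have := poch_pos h (ℓ + m + 1)
  unfold funkCoeff
  positivity

theorem funkCoeff_zero_zero (h : 0 < lam) : funkCoeff lam 0 0 = 1 := by
  simp [funkCoeff, poch_succ, poch_zero, h.ne']

/-- This and `funkCoeff_succ_left` are the recursions that the Laplacian identity imposes on the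
eigenvalues of power kernels. -/
theorem funkCoeff_succ_right (h : 0 < lam) (ℓ m : ℕ) :
    funkCoeff lam ℓ (m + 1) * (4 * (m + 1) * (lam + ℓ + m + 1)) =
      (ℓ + 2 * m + 2) * (ℓ + 2 * m + 1) * funkCoeff lam ℓ m := by
  have h1 := (poch_pos h (ℓ + m + 1)).ne'
  have h2 : lam + (ℓ + m + 1) ≠ 0 := by positivity
  rw [funkCoeff, funkCoeff, show ℓ + 2 * (m + 1) = ℓ + 2 * m + 1 + 1 by ring,
    show ℓ + (m + 1) + 1 = ℓ + m + 1 + 1 by ring, poch_succ _ (ℓ + m + 1),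
    Nat.factorial_succ, Nat.factorial_succ (ℓ + 2 * m), Nat.factorial_succ m]
  push_cast
  field_simp
  ring

theorem funkCoeff_succ_left (h : 0 < lam) (ℓ m : ℕ) :
    funkCoeff lam (ℓ + 1) m * (2 * (lam + ℓ + m + 1)) =
      (ℓ + 2 * m + 1) * funkCoeff lam ℓ m := by
  have h1 := (poch_pos h (ℓ + m + 1)).ne'
  have h2 : lam + (ℓ + m + 1) ≠ 0 := by positivity
  rw [funkCoeff, funkCoeff, show ℓ + 1 + 2 * m = ℓ + 2 * m + 1 by ring,
    show ℓ + 1 + m + 1 = ℓ + m + 1 + 1 by ring, poch_succ _ (ℓ + m + 1),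
    Nat.factorial_succ (ℓ + 2 * m)]
  push_cast
  field_simp
  ring

/-- Both coefficients belong to the same power `ℓ + 2 + 2m`, acting in degrees `ℓ + 2` and `ℓ`; this
is what makes `β_{ℓ+2}` and `β_ℓ` comparable term by term. -/
theorem funkCoeff_add_two_left (h : 0 < lam) (ℓ m : ℕ) :
    funkCoeff lam (ℓ + 2) m * (lam + ℓ + m + 2) = (m + 1) * funkCoeff lam ℓ (m + 1) := by
  have h1 := (poch_pos h (ℓ + m + 2)).ne'
  have h2 : lam + (ℓ + m + 2) ≠ 0 := by positivity
  rw [funkCoeff, funkCoeff, show ℓ + 2 * (m + 1) = ℓ + 2 + 2 * m by ring,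
    show ℓ + (m + 1) + 1 = ℓ + m + 2 by ring, show ℓ + 2 + m + 1 = ℓ + m + 2 + 1 by ring,
    poch_succ _ (ℓ + m + 2), Nat.factorial_succ m]
  push_cast
  field_simp
  ring

theorem funkCoeff_add_two_left_lt (h : 0 < lam) (ℓ m : ℕ) :
    funkCoeff lam (ℓ + 2) m < funkCoeff lam ℓ (m + 1) := by
  have h1 := funkCoeff_add_two_left h ℓ m
  have h2 := funkCoeff_pos h (ℓ + 2) m
  have h3 : (m + 1 : ℝ) < lam + ℓ + m + 2 := by linarith [ℓ.cast_nonneg (α := ℝ)]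
  have h4 : (0 : ℝ) < m + 1 := by positivity
  nlinarith

theorem funkCoeff_zero_succ_lt (h : 0 < lam) (m : ℕ) :
    funkCoeff lam 0 (m + 1) < funkCoeff lam 0 m := by
  have h1 := funkCoeff_succ_right h 0 m
  have h2 := funkCoeff_pos h 0 m
  have h3 : (0 : ℝ) < m + 1 := by positivity
  have h5 := funkCoeff_pos h 0 (m + 1)
  push_cast at h1
  have h4 : funkCoeff lam 0 (m + 1) * (2 * (lam + m + 1)) = (2 * m + 1) * funkCoeff lam 0 m := by
    have h6 : (2 * (m + 1) : ℝ) ≠ 0 := by positivity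
    refine mul_left_cancel₀ h6 ?_
    linarith
  nlinarith

theorem strictAnti_funkCoeff_zero (h : 0 < lam) : StrictAnti (funkCoeff lam 0) :=
  strictAnti_nat_of_succ_lt fun m => funkCoeff_zero_succ_lt h m

/-- This bound lets `∑ aₙ` dominate the series for `β_ℓ`. -/
theorem funkCoeff_le_one (h : 0 < lam) (ℓ m : ℕ) : funkCoeff lam ℓ m ≤ 1 := by
  induction ℓ with
  | zero =>
    rw [← funkCoeff_zero_zero h]
    exact (strictAnti_funkCoeff_zero h).antitone (Nat.zero_le m)
  | succ ℓ ih =>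
    have h1 := funkCoeff_succ_left h ℓ m
    have h2 := funkCoeff_pos h ℓ m
    have h3 := funkCoeff_pos h (ℓ + 1) m
    have h4 := ℓ.cast_nonneg (α := ℝ)
    have h5 := m.cast_nonneg (α := ℝ)
    nlinarith

end FunkCoeff

/-! ### Funk–Hecke formula for powers of the inner product -/

section FunkHecke

variable {d : ℕ}

/-- The linear form `⟨x, ·⟩`. -/
def linForm (x : EuclideanSpace ℝ (Fin d)) : MvPolynomial (Fin d) ℝ :=
  ∑ i, MvPolynomial.C (x i) * MvPolynomial.X i

theorem isHomogeneous_linForm (x : EuclideanSpace ℝ (Fin d)) : (linForm x).IsHomogeneous 1 :=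
  MvPolynomial.IsHomogeneous.sum _ _ _ fun i _ => by
    simpa using (MvPolynomial.isHomogeneous_C (Fin d) (x i)).mul (MvPolynomial.isHomogeneous_X ℝ i)

theorem isHomogeneous_linForm_pow (x : EuclideanSpace ℝ (Fin d)) (n : ℕ) :
    (linForm x ^ n).IsHomogeneous n := by
  simpa using (isHomogeneous_linForm x).pow n

theorem restrictSphere_linForm (x : EuclideanSpace ℝ (Fin d)) (y : Sph d) :
    restrictSphere d (linForm x) y = inner ℝ x (y : EuclideanSpace ℝ (Fin d)) := by
  rw [restrictSphere_apply, linForm, map_sum, PiLp.inner_apply]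
  simp [mul_comm]

theorem pderiv_linForm (x : EuclideanSpace ℝ (Fin d)) (i : Fin d) :
    MvPolynomial.pderiv i (linForm x) = MvPolynomial.C (x i) := by
  rw [linForm, map_sum, Finset.sum_eq_single i]
  · simp
  · intro j _ hj
    rw [MvPolynomial.pderiv_C_mul, MvPolynomial.pderiv_X_of_ne hj, mul_zero]
  · simp

theorem pderiv_linForm_pow (x : EuclideanSpace ℝ (Fin d)) (i : Fin d) (n : ℕ) :
    MvPolynomial.pderiv i (linForm x ^ n) =
      (n : ℝ) • (linForm x ^ (n - 1) * MvPolynomial.C (x i)) := by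
  rw [MvPolynomial.pderiv_pow, pderiv_linForm, MvPolynomial.smul_eq_C_mul]
  simp [mul_assoc]

theorem laplacian_linForm_pow (x : Sph d) (n : ℕ) :
    polyLaplacian d (linForm (x : EuclideanSpace ℝ (Fin d)) ^ n) =
      ((n : ℝ) * (n - 1)) • linForm (x : EuclideanSpace ℝ (Fin d)) ^ (n - 2) := by
  have hx : ∑ i, (x : EuclideanSpace ℝ (Fin d)) i ^ 2 = 1 := by
    rw [← EuclideanSpace.real_norm_sq_eq]
    simp
  have h : ∀ i, MvPolynomial.pderiv i (MvPolynomial.pderiv i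
      (linForm (x : EuclideanSpace ℝ (Fin d)) ^ n)) = ((x : EuclideanSpace ℝ (Fin d)) i ^ 2) •
        (((n : ℝ) * (n - 1)) • linForm (x : EuclideanSpace ℝ (Fin d)) ^ (n - 2)) := by
    intro i
    rw [pderiv_linForm_pow, Derivation.map_smul, mul_comm (linForm _ ^ _), MvPolynomial.pderiv_C_mul,
      pderiv_linForm_pow]
    rcases Nat.eq_zero_or_pos n with rfl | hn
    · simp
    · rw [Nat.cast_sub hn, Nat.sub_sub]
      simp only [MvPolynomial.smul_eq_C_mul, map_mul, map_pow, Nat.cast_one]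
      ring
  rw [polyLaplacian_apply, Finset.sum_congr rfl fun i _ => h i, ← Finset.sum_smul, hx, one_smul]

/-- The directional derivative of a polynomial. -/
def dirDeriv (x : EuclideanSpace ℝ (Fin d)) (P : MvPolynomial (Fin d) ℝ) :
    MvPolynomial (Fin d) ℝ :=
  ∑ i, x i • MvPolynomial.pderiv i P

theorem dirDeriv_mem_harmonicPoly {ℓ : ℕ} {H : MvPolynomial (Fin d) ℝ}
    (hH : H ∈ harmonicPoly d ℓ) (x : EuclideanSpace ℝ (Fin d)) :
    dirDeriv x H ∈ harmonicPoly d (ℓ - 1) :=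
  Submodule.sum_mem _ fun i _ => Submodule.smul_mem _ _ (pderiv_mem_harmonicPoly hH i)

/-- Euler's identity, available because the direction of differentiation is also the point of
evaluation. -/
theorem restrictSphere_dirDeriv {ℓ : ℕ} {H : MvPolynomial (Fin d) ℝ} (hH : H.IsHomogeneous ℓ)
    (x : Sph d) :
    restrictSphere d (dirDeriv (x : EuclideanSpace ℝ (Fin d)) H) x =
      ℓ * restrictSphere d H x := by
  have h := congrArg (MvPolynomial.eval fun i => (x : EuclideanSpace ℝ (Fin d)) i)
    hH.sum_X_mul_pderiv
  simp only [map_sum, map_nsmul, map_mul, MvPolynomial.eval_X] at h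
  rw [restrictSphere_apply, restrictSphere_apply, dirDeriv, map_sum]
  simp only [MvPolynomial.smul_eval]
  rw [h, nsmul_eq_mul]

theorem sphereInt_linForm_pow_mul_step (hd : 2 ≤ d) (x : Sph d) (n : ℕ) {ℓ : ℕ}
    {H : MvPolynomial (Fin d) ℝ} (hH : H ∈ harmonicPoly d ℓ) :
    ((n : ℝ) + ℓ) * (n + ℓ + d - 2) * sphereInt d (linForm (x : EuclideanSpace ℝ (Fin d)) ^ n * H) =
      n * (n - 1) * sphereInt d (linForm (x : EuclideanSpace ℝ (Fin d)) ^ (n - 2) * H) +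
      2 * n * sphereInt d (linForm (x : EuclideanSpace ℝ (Fin d)) ^ (n - 1) *
        dirDeriv (x : EuclideanSpace ℝ (Fin d)) H) := by
  have h := sphereInt_laplacian hd ((isHomogeneous_linForm_pow
    (x : EuclideanSpace ℝ (Fin d)) n).mul hH.1)
  have h1 : ∑ i, MvPolynomial.pderiv i (linForm (x : EuclideanSpace ℝ (Fin d)) ^ n) *
      MvPolynomial.pderiv i H = (n : ℝ) • (linForm (x : EuclideanSpace ℝ (Fin d)) ^ (n - 1) *
        dirDeriv (x : EuclideanSpace ℝ (Fin d)) H) := by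
    rw [dirDeriv, Finset.mul_sum, Finset.smul_sum]
    refine Finset.sum_congr rfl fun i _ => ?_
    rw [pderiv_linForm_pow]
    simp only [MvPolynomial.smul_eq_C_mul]
    ring
  rw [laplacian_mul, (mem_harmonicPoly.1 hH).2, mul_zero, add_zero, h1, laplacian_linForm_pow,
    smul_mul_assoc, two_mul, map_add, map_add, map_smul, map_smul, smul_eq_mul, smul_eq_mul] at h
  push_cast at h
  linarith

theorem sphereInt_of_isHomogeneous_zero (hd : 1 ≤ d) {P : MvPolynomial (Fin d) ℝ}
    (hP : P.IsHomogeneous 0) (x : Sph d) : sphereInt d P = restrictSphere d P x := by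
  have := unif_isProbabilityMeasure d hd
  rw [MvPolynomial.totalDegree_eq_zero_iff_eq_C.1 (Nat.le_zero.1 hP.totalDegree_le)]
  change ∫ y, restrictSphere d _ y ∂(unif d) = _
  simp [restrictSphere_apply]

/-- The Funk–Hecke formula for powers. -/
theorem sphereInt_linForm_pow_mul (hd : 3 ≤ d) (x : Sph d) (n : ℕ) :
    ∀ (ℓ m : ℕ) (H : MvPolynomial (Fin d) ℝ), ℓ + 2 * m = n → H ∈ harmonicPoly d ℓ →
      sphereInt d (linForm (x : EuclideanSpace ℝ (Fin d)) ^ n * H) =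
        funkCoeff (((d : ℝ) - 2) / 2) ℓ m * restrictSphere d H x := by
  have hd3 : (3 : ℝ) ≤ d := by exact_mod_cast hd
  have hlam : 0 < ((d : ℝ) - 2) / 2 := by linarith
  induction n using Nat.strong_induction_on with
  | _ n ih =>
    intro ℓ m H hn hH
    have hstep := sphereInt_linForm_pow_mul_step (by omega) x n hH
    have hn' : (n : ℝ) = ℓ + 2 * m := by exact_mod_cast hn.symm
    rcases Nat.eq_zero_or_pos n with rfl | hpos
    · obtain ⟨rfl, rfl⟩ : ℓ = 0 ∧ m = 0 := by omega
      rw [pow_zero, one_mul, funkCoeff_zero_zero hlam, one_mul]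
      exact sphereInt_of_isHomogeneous_zero (by omega) hH.1 x
    -- For `m = 0` the left side vanishes: either `n = 1`, or the power has degree `ℓ - 2 < ℓ` and
    -- is orthogonal to `H`. Otherwise induction applies with `m - 1`.
    have h1 : (n : ℝ) * (n - 1) *
        sphereInt d (linForm (x : EuclideanSpace ℝ (Fin d)) ^ (n - 2) * H) =
        4 * m * (((d : ℝ) - 2) / 2 + ℓ + m) *
          (funkCoeff (((d : ℝ) - 2) / 2) ℓ m * restrictSphere d H x) := by
      rcases m with _ | m
      · have h0 : (n : ℝ) * (n - 1) *
            sphereInt d (linForm (x : EuclideanSpace ℝ (Fin d)) ^ (n - 2) * H) = 0 := by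
          rcases Nat.lt_or_ge n 2 with h2 | h2
          · obtain rfl : n = 1 := by omega
            simp
          · rw [mul_comm (linForm _ ^ _), sphereInt_harmonic_mul_eq_zero (by omega) (n - 2) ℓ H _ hH
              (isHomogeneous_linForm_pow _ _) (by omega), mul_zero]
        rw [h0]
        simp
      · rw [ih (n - 2) (by omega) ℓ m H (by omega) hH, hn']
        have hA := funkCoeff_succ_right hlam ℓ m
        push_cast
        linear_combination (-restrictSphere d H x) * hA
    -- The directional derivative of `H` is harmonic of degree `ℓ - 1`, with value `ℓ H(x)` at `x`;
    -- for `ℓ = 0` it is zero.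
    have h2 : 2 * (n : ℝ) * sphereInt d (linForm (x : EuclideanSpace ℝ (Fin d)) ^ (n - 1) *
        dirDeriv (x : EuclideanSpace ℝ (Fin d)) H) =
        4 * ℓ * (((d : ℝ) - 2) / 2 + ℓ + m) *
          (funkCoeff (((d : ℝ) - 2) / 2) ℓ m * restrictSphere d H x) := by
      rcases ℓ with _ | ℓ
      · have h0 : dirDeriv (x : EuclideanSpace ℝ (Fin d)) H = 0 :=
          Finset.sum_eq_zero fun i _ => by rw [pderiv_of_isHomogeneous_zero hH.1, smul_zero]
        rw [h0]
        simp
      · rw [ih (n - 1) (by omega) ℓ m _ (by omega) (dirDeriv_mem_harmonicPoly hH _),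
          restrictSphere_dirDeriv hH.1, hn']
        have hB := funkCoeff_succ_left hlam ℓ m
        push_cast
        linear_combination (-(2 * (ℓ + 1) * restrictSphere d H x)) * hB
    rw [h1, h2, ← add_mul, hn'] at hstep
    have hℓm : 0 < (ℓ : ℝ) + m := by exact_mod_cast (by omega : 0 < ℓ + m)
    -- With `n = ℓ + 2m` this is the factor `(n + ℓ)(n + ℓ + d - 2)` of the recursion.
    have hne : 4 * ((ℓ : ℝ) + m) * (((d : ℝ) - 2) / 2 + ℓ + m) ≠ 0 := by positivity
    refine mul_left_cancel₀ hne ?_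
    linear_combination hstep

/-- Either `n < ℓ` and orthogonality applies, or `n + ℓ` is odd and the mean vanishes by parity. -/
theorem sphereInt_linForm_pow_mul_eq_zero (hd : 3 ≤ d) (x : Sph d) {n ℓ : ℕ}
    (hn : ∀ m, ℓ + 2 * m ≠ n) {H : MvPolynomial (Fin d) ℝ} (hH : H ∈ harmonicPoly d ℓ) :
    sphereInt d (linForm (x : EuclideanSpace ℝ (Fin d)) ^ n * H) = 0 := by
  rcases lt_or_ge n ℓ with h | h
  · rw [mul_comm]
    exact sphereInt_harmonic_mul_eq_zero (by omega) n ℓ H _ hH (isHomogeneous_linForm_pow _ n) h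
  · refine sphereInt_eq_zero_of_odd (by omega) (n + ℓ) _
      ((isHomogeneous_linForm_pow _ n).mul hH.1) ?_
    by_contra hodd
    rw [Nat.not_odd_iff_even] at hodd
    exact hn ((n - ℓ) / 2) (by rcases hodd with ⟨k, hk⟩; omega)

end FunkHecke

/-! ### Dimensions of the spaces of harmonics -/

section Dimension

variable {d : ℕ}

theorem finrank_homogeneousSubmodule (d n : ℕ) :
    Module.finrank ℝ (MvPolynomial.homogeneousSubmodule (Fin d) ℝ n) = (d + n - 1).choose n := by
  have h : {s : Fin d →₀ ℕ | s.degree = n} =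
      ((Finset.univ : Finset (Fin d)).finsuppAntidiag n : Set (Fin d →₀ ℕ)) := by
    ext s
    simp [Finset.mem_finsuppAntidiag, Finsupp.degree_eq_sum]
  rw [MvPolynomial.homogeneousSubmodule_eq_finsupp_supported, h,
    (AddMonoidAlgebra.supportedEquivFinsupp _).finrank_eq, Module.finrank_finsupp_self]
  simp [Finset.card_finsuppAntidiag_nat_eq_choose]

theorem choose_eq_poch (d n : ℕ) :
    (((d + n - 1).choose n : ℕ) : ℝ) = poch d n / n.factorial := by
  rw [poch, ascPochhammer_nat_eq_natCast_ascFactorial, Nat.ascFactorial_eq_factorial_mul_choose']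
  push_cast
  field_simp

theorem gegenbauer_one (lam : ℝ) (n : ℕ) : gegenbauer lam n 1 = poch (2 * lam) n / n.factorial := by
  rw [gegenbauer, Finset.sum_eq_single 0]
  · simp [poch_zero]
  · intro k _ hk
    simp [hk]
  · simp

theorem poch_add_two (a : ℝ) (n : ℕ) : poch a (n + 2) = a * (a + 1) * poch (a + 2) n := by
  induction n with
  | zero => simp [poch_succ, poch_zero]
  | succ n ih =>
    rw [show n + 1 + 2 = n + 2 + 1 by ring, poch_succ, ih, poch_succ]
    push_cast
    ring

theorem finrank_harmonicPoly_of_lt {ℓ : ℕ} (hℓ : ℓ < 2) :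
    Module.finrank ℝ (harmonicPoly d ℓ) = (d + ℓ - 1).choose ℓ := by
  have h : harmonicPoly d ℓ = MvPolynomial.homogeneousSubmodule (Fin d) ℝ ℓ :=
    inf_eq_left.2 fun P hP => laplacian_of_isHomogeneous_lt hP hℓ
  rw [h, finrank_homogeneousSubmodule]

/-- Rank–nullity for the surjective Laplacian. -/
theorem finrank_harmonicPoly_add_two (hd : 2 ≤ d) (n : ℕ) :
    (d + n - 1).choose n + Module.finrank ℝ (harmonicPoly d (n + 2)) =
      (d + (n + 2) - 1).choose (n + 2) := by
  have h := (laplacianHom d n).finrank_range_add_finrank_ker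
  rw [LinearMap.range_eq_top.2 (surjective_laplacianHom hd n), finrank_top,
    finrank_homogeneousSubmodule, finrank_homogeneousSubmodule] at h
  have h2 : (LinearMap.ker (laplacianHom d n)).map
      (MvPolynomial.homogeneousSubmodule (Fin d) ℝ (n + 2)).subtype = harmonicPoly d (n + 2) := by
    ext P
    constructor
    · rintro ⟨Q, hQ, rfl⟩
      exact ⟨Q.2, congrArg Subtype.val hQ⟩
    · rintro ⟨h1, h2⟩
      exact ⟨⟨P, h1⟩, Subtype.ext h2, rfl⟩
  rw [← h, ← h2, (Submodule.equivMapOfInjective _ (Submodule.subtype_injective _) _).finrank_eq]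

theorem finrank_harmonics (hd : 3 ≤ d) (ℓ : ℕ) :
    (Module.finrank ℝ (harmonics d ℓ) : ℝ) = harmonicsDim d ℓ := by
  have h1 : Module.finrank ℝ (harmonics d ℓ) = Module.finrank ℝ (harmonicPoly d ℓ) := by
    rw [harmonics, ← (Submodule.equivMapOfInjective _ (ContinuousMap.toLp_injective (unif d))
      _).finrank_eq]
    have hinj : Function.Injective ((restrictSphere d).domRestrict (harmonicPoly d ℓ)) := by
      rw [← LinearMap.ker_eq_bot, LinearMap.ker_eq_bot']
      intro P hP
      exact Subtype.ext (eq_zero_of_restrictSphere_eq_zero (by omega) P.2.1 hP)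
    rw [(LinearEquiv.ofInjective _ hinj).finrank_eq, LinearMap.range_domRestrict]
  -- Here `e = d - 2 = 2 lam`, so the Gegenbauer value is `(e)_ℓ / ℓ!` while the binomial
  -- coefficients involve `(e + 2)_n`; `poch_add_two` relates the two.
  obtain ⟨e, rfl⟩ : ∃ e, d = e + 2 := Nat.exists_eq_add_of_le' (by omega)
  have he : (e : ℝ) ≠ 0 := Nat.cast_ne_zero.2 (by omega)
  have hlam : (((e + 2 : ℕ) : ℝ) - 2) / 2 = e / 2 := by push_cast; ring
  rw [h1, harmonicsDim, gegenbauer_one, hlam, mul_div_cancel₀ _ (two_ne_zero' ℝ)]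
  rcases lt_or_ge ℓ 2 with hℓ | hℓ
  · rw [finrank_harmonicPoly_of_lt hℓ]
    interval_cases ℓ
    · simp [poch_zero, he]
    · simp [poch_succ, poch_zero]
      field_simp
      ring
  · obtain ⟨n, rfl⟩ := Nat.exists_eq_add_of_le' hℓ
    have h2 := congrArg (Nat.cast (R := ℝ)) (finrank_harmonicPoly_add_two (d := e + 2) (by omega) n)
    rw [Nat.cast_add, choose_eq_poch, choose_eq_poch, poch_succ,
      poch_succ, Nat.factorial_succ, Nat.factorial_succ] at h2
    rw [poch_add_two, Nat.factorial_succ, Nat.factorial_succ]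
    have h3 := eq_sub_of_add_eq' h2
    rw [h3]
    push_cast
    field_simp
    ring

end Dimension

/-! ### Values and order of the eigenvalues -/

section Beta

variable {d : ℕ}

theorem half_dim_sub_two_pos (hd : 3 ≤ d) : 0 < ((d : ℝ) - 2) / 2 := by
  have hd3 : (3 : ℝ) ≤ d := by exact_mod_cast hd
  linarith

theorem lam_mul_betaTerm (ℓ m : ℕ) :
    ((d : ℝ) - 2) / 2 * betaTerm d profile ℓ m =
      profileCoeff (ℓ + 2 * m) * funkCoeff (((d : ℝ) - 2) / 2) ℓ m := by
  rw [betaTerm, iteratedDeriv_profile, funkCoeff]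
  ring

theorem summable_profileCoeff_comp (ℓ : ℕ) : Summable fun m => profileCoeff (ℓ + 2 * m) :=
  summable_profileCoeff.comp_injective fun a b h => by simpa using h

theorem summable_profileCoeff_mul_funkCoeff (hd : 3 ≤ d) (ℓ : ℕ) :
    Summable fun m => profileCoeff (ℓ + 2 * m) * funkCoeff (((d : ℝ) - 2) / 2) ℓ m := by
  have h := half_dim_sub_two_pos hd
  refine Summable.of_nonneg_of_le
    (fun m => mul_nonneg (profileCoeff_nonneg _) (funkCoeff_pos h ℓ m).le)
    (fun m => ?_) (summable_profileCoeff_comp ℓ)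
  exact mul_le_of_le_one_right (profileCoeff_nonneg _) (funkCoeff_le_one h ℓ m)

theorem summable_betaTerm (hd : 3 ≤ d) (ℓ : ℕ) : Summable (betaTerm d profile ℓ) := by
  rw [← summable_mul_left_iff (half_dim_sub_two_pos hd).ne']
  simpa only [lam_mul_betaTerm] using summable_profileCoeff_mul_funkCoeff hd ℓ

theorem hasSum_beta (hd : 3 ≤ d) (ℓ : ℕ) :
    HasSum (fun m => profileCoeff (ℓ + 2 * m) * funkCoeff (((d : ℝ) - 2) / 2) ℓ m) (beta d ℓ) := by
  have h := (summable_betaTerm hd ℓ).hasSum.mul_left (((d : ℝ) - 2) / 2)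
  simp only [lam_mul_betaTerm] at h
  exact h

theorem profileCoeff_add_two_mul_pos {ℓ : ℕ} (hℓ : Even ℓ) (h0 : 0 < ℓ) (m : ℕ) :
    0 < profileCoeff (ℓ + 2 * m) := by
  obtain ⟨k, rfl⟩ := hℓ
  obtain ⟨j, rfl⟩ := Nat.exists_eq_succ_of_ne_zero (by omega : k ≠ 0)
  rw [show j.succ + j.succ + 2 * m = 2 * (j + m) + 2 by omega]
  exact profileCoeff_even_pos _

theorem beta_one (hd : 3 ≤ d) : beta d 1 = 1 / (4 * (d : ℝ)) := by
  have h := half_dim_sub_two_pos hd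
  have hs := hasSum_single (f := fun m => profileCoeff (1 + 2 * m) *
    funkCoeff (((d : ℝ) - 2) / 2) 1 m) 0 fun m hm => by
      obtain ⟨j, rfl⟩ := Nat.exists_eq_succ_of_ne_zero hm
      rw [show 1 + 2 * j.succ = 2 * j + 3 by omega, profileCoeff_odd, zero_mul]
  rw [(hasSum_beta hd 1).unique hs]
  have h1 := funkCoeff_succ_left h 0 0
  rw [funkCoeff_zero_zero h] at h1
  push_cast at h1
  have hd0 : (d : ℝ) ≠ 0 := Nat.cast_ne_zero.2 (by omega)
  simp only [mul_zero, add_zero, profileCoeff_one, zero_add] at h1 ⊢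
  field_simp
  linarith

theorem beta_odd (hd : 3 ≤ d) {k : ℕ} (hk : 1 ≤ k) : beta d (2 * k + 1) = 0 := by
  refine (hasSum_beta hd (2 * k + 1)).unique ?_
  convert hasSum_zero with m
  rw [show 2 * k + 1 + 2 * m = 2 * (k - 1 + m) + 3 by omega, profileCoeff_odd, zero_mul]

theorem beta_pos_of_even (hd : 3 ≤ d) {ℓ : ℕ} (hℓ : Even ℓ) : 0 < beta d ℓ := by
  have h := half_dim_sub_two_pos hd
  rw [← (hasSum_beta hd ℓ).tsum_eq]
  -- The positive term is taken at `m = 1`, since for `ℓ = 0` the term `m = 0` carries `a₀ = 0`.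
  refine (summable_profileCoeff_mul_funkCoeff hd ℓ).tsum_pos
    (fun m => mul_nonneg (profileCoeff_nonneg _) (funkCoeff_pos h ℓ m).le) 1
    (mul_pos ?_ (funkCoeff_pos h ℓ 1))
  obtain ⟨k, rfl⟩ := hℓ
  rw [show k + k + 2 * 1 = 2 * k + 2 by omega]
  exact profileCoeff_even_pos k

/-- Dropping the term `m = 0` aligns the powers with those of `β_{ℓ+2}`. -/
theorem hasSum_beta_tail (hd : 3 ≤ d) (ℓ : ℕ) :
    HasSum (fun m => profileCoeff (ℓ + 2 + 2 * m) * funkCoeff (((d : ℝ) - 2) / 2) ℓ (m + 1))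
      (beta d ℓ - profileCoeff ℓ * funkCoeff (((d : ℝ) - 2) / 2) ℓ 0) := by
  have h := (hasSum_nat_add_iff' 1).2 (hasSum_beta hd ℓ)
  simp only [Finset.sum_range_one, mul_zero, add_zero] at h
  refine h.congr_fun fun m => ?_
  rw [show ℓ + 2 * (m + 1) = ℓ + 2 + 2 * m by ring]

theorem beta_add_two_le_sub (hd : 3 ≤ d) (ℓ : ℕ) :
    beta d (ℓ + 2) ≤ beta d ℓ - profileCoeff ℓ * funkCoeff (((d : ℝ) - 2) / 2) ℓ 0 :=
  hasSum_le (fun m => mul_le_mul_of_nonneg_left (funkCoeff_add_two_left_lt (half_dim_sub_two_pos hd) ℓ m).le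
    (profileCoeff_nonneg _)) (hasSum_beta hd (ℓ + 2)) (hasSum_beta_tail hd ℓ)

theorem beta_add_two_le (hd : 3 ≤ d) (ℓ : ℕ) : beta d (ℓ + 2) ≤ beta d ℓ :=
  (beta_add_two_le_sub hd ℓ).trans (sub_le_self _ (mul_nonneg (profileCoeff_nonneg _)
    (funkCoeff_pos (half_dim_sub_two_pos hd) _ _).le))

theorem beta_add_two_lt (hd : 3 ≤ d) {ℓ : ℕ} (hℓ : Even ℓ) : beta d (ℓ + 2) < beta d ℓ := by
  have h := half_dim_sub_two_pos hd
  have hlt : profileCoeff (ℓ + 2 + 2 * 0) * funkCoeff (((d : ℝ) - 2) / 2) (ℓ + 2) 0 <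
      profileCoeff (ℓ + 2 + 2 * 0) * funkCoeff (((d : ℝ) - 2) / 2) ℓ (0 + 1) :=
    mul_lt_mul_of_pos_left (funkCoeff_add_two_left_lt h ℓ 0)
      (profileCoeff_add_two_mul_pos (hℓ.add even_two) (Nat.succ_pos _) 0)
  have hle : ∀ m, profileCoeff (ℓ + 2 + 2 * m) * funkCoeff (((d : ℝ) - 2) / 2) (ℓ + 2) m ≤
      profileCoeff (ℓ + 2 + 2 * m) * funkCoeff (((d : ℝ) - 2) / 2) ℓ (m + 1) := fun m =>
    mul_le_mul_of_nonneg_left (funkCoeff_add_two_left_lt h ℓ m).le (profileCoeff_nonneg _)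
  exact (hasSum_lt hle hlt (hasSum_beta hd (ℓ + 2)) (hasSum_beta_tail hd ℓ)).trans_le
    (sub_le_self _ (mul_nonneg (profileCoeff_nonneg _) (funkCoeff_pos h _ _).le))

theorem strictAnti_beta_even (hd : 3 ≤ d) : StrictAnti fun j : ℕ => beta d (2 * j) :=
  strictAnti_nat_of_succ_lt fun j => beta_add_two_lt hd (even_two_mul j)

/-- This is `arcsin 1 / (2π)`. -/
theorem hasSum_profileCoeff_even :
    HasSum (fun m => profileCoeff (0 + 2 + 2 * m)) (1 / 4) := by
  have h := (hasSum_arcsin (u := 1) (by simp)).div_const (2 * Real.pi)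
  rw [Real.arcsin_one, show Real.pi / 2 / (2 * Real.pi) = 1 / 4 by
    have := Real.pi_ne_zero
    field_simp
    norm_num] at h
  refine h.congr_fun fun m => ?_
  rw [show 0 + 2 + 2 * m = 2 * m + 2 by ring, profileCoeff_even]
  simp

theorem beta_zero_lt (hd : 3 ≤ d) : beta d 0 < beta d 1 := by
  have h := half_dim_sub_two_pos hd
  have ha := strictAnti_funkCoeff_zero h
  have h1 : funkCoeff (((d : ℝ) - 2) / 2) 0 1 = 1 / d := by
    have h2 := funkCoeff_succ_right h 0 0
    have hd0 : (d : ℝ) ≠ 0 := Nat.cast_ne_zero.2 (by omega)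
    rw [funkCoeff_zero_zero h] at h2
    push_cast at h2
    simp only [zero_add] at h2
    field_simp
    linarith
  have hs := hasSum_beta_tail hd 0
  have h0 : profileCoeff 0 = 0 := by rw [profileCoeff_of_forall_ne (by omega), if_neg (by omega)]
  rw [h0, zero_mul, sub_zero] at hs
  -- Every weight `funkCoeff lam 0 (m + 1)` is at most the one at `m = 0`, namely `1/d`. Equality
  -- holds at `m = 0`, so strictness is taken from `m = 1`.
  have hlt := hasSum_lt (i := 1) (fun m => mul_le_mul_of_nonneg_left
    (ha.antitone (by omega : 1 ≤ m + 1)) (profileCoeff_nonneg (0 + 2 + 2 * m)))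
    (mul_lt_mul_of_pos_left (ha (by omega : 1 < 1 + 1))
      (profileCoeff_add_two_mul_pos even_two two_pos 1))
    hs (hasSum_profileCoeff_even.mul_right _)
  rw [h1] at hlt
  rw [beta_one hd]
  refine hlt.trans_eq ?_
  rw [div_mul_div_comm, one_mul]

theorem eq_one_or_even_or_odd (ℓ : ℕ) :
    (ℓ = 1 ∨ Even ℓ) ∨ (∃ k, ℓ = 2 * (k + 1) + 1) := by
  rcases Nat.even_or_odd' ℓ with ⟨c, rfl | rfl⟩
  · exact Or.inl (Or.inr (even_two_mul c))
  · rcases c with _ | c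
    · exact Or.inl (Or.inl rfl)
    · exact Or.inr ⟨c, rfl⟩

theorem beta_even_lt_beta_one (hd : 3 ≤ d) {ℓ : ℕ} (hℓ : Even ℓ) : beta d ℓ < beta d 1 := by
  obtain ⟨j, rfl⟩ := hℓ.exists_two_nsmul
  rw [nsmul_eq_mul, Nat.cast_ofNat]
  exact ((strictAnti_beta_even hd).antitone (Nat.zero_le j)).trans_lt (beta_zero_lt hd)

theorem beta_pos (hd : 3 ≤ d) {ℓ : ℕ} (hℓ : ℓ = 1 ∨ Even ℓ) : 0 < beta d ℓ := by
  rcases hℓ with rfl | hℓ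
  · exact (beta_pos_of_even hd Even.zero).trans (beta_zero_lt hd)
  · exact beta_pos_of_even hd hℓ

theorem eq_of_beta_eq (hd : 3 ≤ d) {ℓ m : ℕ} (hℓ : ℓ = 1 ∨ Even ℓ) (h : beta d m = beta d ℓ) :
    m = ℓ := by
  rcases eq_one_or_even_or_odd m with hm | ⟨k, rfl⟩
  · rcases hℓ with rfl | hℓ <;> rcases hm with rfl | hm
    · rfl
    · exact absurd h (beta_even_lt_beta_one hd hm).ne
    · exact absurd h (beta_even_lt_beta_one hd hℓ).ne'
    · obtain ⟨i, rfl⟩ := hℓ.exists_two_nsmul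
      obtain ⟨j, rfl⟩ := hm.exists_two_nsmul
      rw [(strictAnti_beta_even hd).injective (by simpa using h : beta d (2 * j) = beta d (2 * i))]
  · rw [beta_odd hd (by omega)] at h
    exact absurd h (beta_pos hd hℓ).ne

end Beta

/-! ### Action on harmonics, and symmetry of the operator -/

section Operator

variable {d : ℕ}

theorem abs_inner_sphere_le_one (x y : Sph d) :
    |inner ℝ (x : EuclideanSpace ℝ (Fin d)) (y : EuclideanSpace ℝ (Fin d))| ≤ 1 := by
  simpa using abs_real_inner_le_norm (x : EuclideanSpace ℝ (Fin d)) (y : EuclideanSpace ℝ (Fin d))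

/-- Dominated convergence: the terms are bounded by `aₙ` times the supremum of `|P|` on the sphere.
-/
theorem hasSum_integral_kernel_mul (x : Sph d) (P : MvPolynomial (Fin d) ℝ) :
    HasSum (fun n => profileCoeff n *
        sphereInt d (linForm (x : EuclideanSpace ℝ (Fin d)) ^ n * P))
      (∫ y, kernel d x y * restrictSphere d P y ∂(unif d)) := by
  obtain ⟨C, hC⟩ := isCompact_univ.exists_bound_of_continuousOn
    (restrictSphere d P).continuous.continuousOn
  have hpow : ∀ n, ∀ y, restrictSphere d (linForm (x : EuclideanSpace ℝ (Fin d)) ^ n * P) y =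
      inner ℝ (x : EuclideanSpace ℝ (Fin d)) (y : EuclideanSpace ℝ (Fin d)) ^ n *
        restrictSphere d P y := by
    intro n y
    rw [restrictSphere_apply, map_mul, map_pow, ← restrictSphere_apply, ← restrictSphere_apply,
      restrictSphere_linForm]
  have hbound : ∀ n, ∀ y, ‖profileCoeff n *
      restrictSphere d (linForm (x : EuclideanSpace ℝ (Fin d)) ^ n * P) y‖ ≤ profileCoeff n * C := by
    intro n y
    rw [hpow, norm_mul, norm_mul, norm_pow, Real.norm_of_nonneg (profileCoeff_nonneg n),
      Real.norm_eq_abs]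
    refine mul_le_mul_of_nonneg_left ?_ (profileCoeff_nonneg n)
    exact (mul_le_of_le_one_left (norm_nonneg _) (pow_le_one₀ (abs_nonneg _)
      (abs_inner_sphere_le_one x y))).trans (hC y (Set.mem_univ y))
  have hsum : ∀ y, HasSum (fun n => profileCoeff n *
      restrictSphere d (linForm (x : EuclideanSpace ℝ (Fin d)) ^ n * P) y)
      (kernel d x y * restrictSphere d P y) := by
    intro y
    refine ((hasSum_profile (abs_inner_sphere_le_one x y)).mul_right
      (restrictSphere d P y)).congr_fun fun n => ?_
    rw [hpow]
    ring
  have h := hasSum_integral_of_dominated_convergence (μ := unif d)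
    (fun n _ => profileCoeff n * C)
    (fun n => ((restrictSphere d (linForm (x : EuclideanSpace ℝ (Fin d)) ^ n *
      P)).continuous.const_mul (profileCoeff n)).aestronglyMeasurable)
    (fun n => Eventually.of_forall (hbound n))
    (Eventually.of_forall fun _ => summable_profileCoeff.mul_right C)
    (integrable_const _) (Eventually.of_forall hsum)
  refine h.congr_fun fun n => ?_
  rw [integral_const_mul]
  rfl

theorem integral_kernel_mul_harmonic (hd : 3 ≤ d) (x : Sph d) {ℓ : ℕ}
    {H : MvPolynomial (Fin d) ℝ} (hH : H ∈ harmonicPoly d ℓ) :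
    ∫ y, kernel d x y * restrictSphere d H y ∂(unif d) = beta d ℓ * restrictSphere d H x := by
  have h1 := hasSum_integral_kernel_mul x H
  have hinj : Function.Injective fun m : ℕ => ℓ + 2 * m := fun a b h => by simpa using h
  rw [← hinj.hasSum_iff] at h1
  · refine h1.unique (((hasSum_beta hd ℓ).mul_right (restrictSphere d H x)).congr_fun fun m => ?_)
    rw [Function.comp_apply, sphereInt_linForm_pow_mul hd x _ ℓ m H rfl hH, mul_assoc]
  · intro n hn
    rw [sphereInt_linForm_pow_mul_eq_zero hd x (fun m hm => hn ⟨m, hm⟩) hH, mul_zero]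

/-- The spherical harmonics of degree `ℓ` are eigenfunctions for `β_ℓ`. -/
theorem integralOp_of_mem_harmonics (hd : 3 ≤ d) {ℓ : ℕ} {g : L2 d} (hg : g ∈ harmonics d ℓ) :
    integralOp d g = beta d ℓ • g := by
  obtain ⟨_, ⟨H, hH, rfl⟩, rfl⟩ := hg
  change ContinuousMap.toLp 2 (unif d) ℝ (kernelIntegral d _) =
    beta d ℓ • ContinuousMap.toLp 2 (unif d) ℝ (restrictSphere d H)
  rw [← map_smul]
  congr 1
  ext x
  rw [ContinuousMap.smul_apply, smul_eq_mul, ← integral_kernel_mul_harmonic hd x hH]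
  refine integral_congr_ae ?_
  filter_upwards [ContinuousMap.coeFn_toLp (p := 2) (𝕜 := ℝ) (unif d) (restrictSphere d H)] with y hy
  exact congrArg (kernel d x y * ·) hy

theorem inner_eq_zero_of_mem_harmonics (hd : 3 ≤ d) {ℓ m : ℕ} (hne : ℓ ≠ m) {f g : L2 d}
    (hf : f ∈ harmonics d ℓ) (hg : g ∈ harmonics d m) : inner ℝ f g = 0 := by
  obtain ⟨_, ⟨P, hP, rfl⟩, rfl⟩ := hf
  obtain ⟨_, ⟨Q, hQ, rfl⟩, rfl⟩ := hg
  have h := sphereInt_harmonic_mul_harmonic (by omega) hne.symm hQ hP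
  refine (ContinuousMap.inner_toLp (unif d) (restrictSphere d P) (restrictSphere d Q)).trans ?_
  rw [← h]
  change _ = ∫ x, restrictSphere d (Q * P) x ∂(unif d)
  rw [restrictSphere_mul]
  rfl

theorem kernel_comm (x y : Sph d) : kernel d x y = kernel d y x := by
  rw [kernel, kernel, real_inner_comm]

/-- Fubini and the symmetry of the bounded kernel. -/
theorem isSymmetric_integralOp (d : ℕ) : (integralOp d).IsSymmetric := by
  intro f g
  obtain ⟨C, hC⟩ := exists_kernel_bound d
  have hint : Integrable (fun p : Sph d × Sph d => kernel d p.1 p.2 * (g p.1 * f p.2))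
      ((unif d).prod (unif d)) :=
    ((integrable_L2 d g).mul_prod (integrable_L2 d f)).bdd_mul (c := C)
      (continuous_kernel d).aestronglyMeasurable (Eventually.of_forall fun p => hC p.1 p.2)
  have h1 : inner ℝ (integralOp d f) g =
      ∫ x, ∫ y, kernel d x y * (g x * f y) ∂(unif d) ∂(unif d) := by
    rw [L2.inner_def]
    refine integral_congr_ae ?_
    filter_upwards [integralOp_ae d f] with x hx
    rw [hx, real_inner_eq_re_inner, RCLike.inner_apply]
    simp only [conj_trivial, RCLike.re_to_real]
    rw [← integral_const_mul]
    refine integral_congr_ae (Eventually.of_forall fun y => ?_)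
    simp only
    ring
  have h2 : inner ℝ f (integralOp d g) =
      ∫ y, ∫ x, kernel d x y * (g x * f y) ∂(unif d) ∂(unif d) := by
    rw [L2.inner_def]
    refine integral_congr_ae ?_
    filter_upwards [integralOp_ae d g] with y hy
    rw [hy, real_inner_eq_re_inner, RCLike.inner_apply]
    simp only [conj_trivial, RCLike.re_to_real]
    rw [← integral_mul_const]
    refine integral_congr_ae (Eventually.of_forall fun x => ?_)
    simp only
    rw [kernel_comm]
    ring
  rw [h1, h2]
  exact integral_integral_swap hint

end Operator

/-! ### Eigenspaces of a diagonal symmetric operator -/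

section Spectral

variable {E : Type*} [NormedAddCommGroup E] [InnerProductSpace ℝ E] [CompleteSpace E]

/-- The eigenspaces of a symmetric operator that is diagonal on an orthogonal family of subspaces
with dense sum. -/
theorem eigenspace_eq_topologicalClosure {T : Module.End ℝ E} (hT : T.IsSymmetric)
    {ι : Type*} {V : ι → Submodule ℝ E} {b : ι → ℝ} (hV : ∀ i, ∀ v ∈ V i, T v = b i • v)
    (horth : ∀ i j, i ≠ j → ∀ v ∈ V i, ∀ w ∈ V j, inner ℝ v w = 0)
    (hdense : (⨆ i, V i).topologicalClosure = ⊤) (c : ℝ) :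
    T.eigenspace c = (⨆ i : {i // b i = c}, V i).topologicalClosure := by
  have hzero : ∀ g : E, (∀ i, ∀ v ∈ V i, inner ℝ v g = 0) → g = 0 := by
    intro g hg
    rw [Submodule.topologicalClosure_eq_top_iff] at hdense
    have hmem : g ∈ (⨆ i, V i)ᗮ := by
      rw [← Submodule.iInf_orthogonal, Submodule.mem_iInf]
      exact fun i v hv => hg i v hv
    rwa [hdense, Submodule.mem_bot] at hmem
  have hperp : ∀ g ∈ T.eigenspace c, ∀ i, b i ≠ c → ∀ v ∈ V i, inner ℝ v g = 0 := by
    intro g hg i hi v hv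
    have h := hT v g
    rw [hV i v hv, Module.End.mem_eigenspace_iff.1 hg, inner_smul_left, inner_smul_right] at h
    simp only [conj_trivial] at h
    have h2 : (b i - c) * inner ℝ v g = 0 := by linarith
    exact (mul_eq_zero.1 h2).resolve_left (sub_ne_zero.2 hi)
  have hclosure : ∀ g ∈ (⨆ i : {i // b i = c}, V i).topologicalClosure, ∀ i, b i ≠ c →
      ∀ v ∈ V i, inner ℝ v g = 0 := by
    intro g hg i hi v hv
    have hle : (⨆ i : {i // b i = c}, V i).topologicalClosure ≤ (V i)ᗮ := by
      refine Submodule.topologicalClosure_minimal _ (iSup_le fun j w hw => ?_)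
        (Submodule.isClosed_orthogonal _)
      exact fun u hu => horth i j (fun hij => hi (hij ▸ j.2)) u hu w hw
    exact hle hg v hv
  set W := (⨆ i : {i // b i = c}, V i).topologicalClosure with hW
  have hVW : ∀ i, b i = c → V i ≤ W := fun i hi =>
    (le_iSup (fun i : {i // b i = c} => V i) ⟨i, hi⟩).trans (Submodule.le_topologicalClosure _)
  refine le_antisymm (fun g hg => ?_) (fun g hg => ?_)
  · have : CompleteSpace W := (Submodule.isClosed_topologicalClosure _).completeSpace_coe
    -- The residual is orthogonal to every `V i`: by projection if `b i = c`, and otherwise because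
    -- both `g` and its projection are orthogonal to `V i`.
    have h0 : g - W.starProjection g = 0 := by
      refine hzero _ fun i v hv => ?_
      by_cases hi : b i = c
      · exact (W.sub_starProjection_mem_orthogonal g) v (hVW i hi hv)
      · rw [inner_sub_right, hperp g hg i hi v hv,
          hclosure _ (W.starProjection_apply_mem g) i hi v hv, sub_zero]
    rw [sub_eq_zero.1 h0]
    exact W.starProjection_apply_mem g
  -- Testing `T g - c g` against each `V i` and moving `T` across by symmetry avoids any appeal to
  -- continuity of `T`.
  · rw [Module.End.mem_eigenspace_iff, ← sub_eq_zero]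
    refine hzero _ fun i v hv => ?_
    rw [inner_sub_right, ← hT, hV i v hv, inner_smul_left, inner_smul_right, conj_trivial]
    by_cases hi : b i = c
    · rw [hi, sub_self]
    · rw [hclosure g hg i hi v hv, mul_zero, mul_zero, sub_self]

end Spectral

/-! ### Spectrum, multiplicities and ranking -/

section Eigenvalues

variable {d : ℕ}

theorem eigenspace_integralOp (hd : 3 ≤ d) (c : ℝ) :
    (integralOp d).eigenspace c =
      (⨆ ℓ : {ℓ // beta d ℓ = c}, harmonics d ℓ).topologicalClosure :=
  eigenspace_eq_topologicalClosure (isSymmetric_integralOp d)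
    (fun _ _ hv => integralOp_of_mem_harmonics hd hv)
    (fun _ _ hij _ hv _ hw => inner_eq_zero_of_mem_harmonics hd hij hv hw)
    (topologicalClosure_iSup_harmonics (by omega)) c

instance finite_harmonics (d ℓ : ℕ) : Module.Finite ℝ (harmonics d ℓ) := by
  have : Module.Finite ℝ (harmonicPoly d ℓ) :=
    Submodule.finiteDimensional_of_le (inf_le_left (b := LinearMap.ker (polyLaplacian d)))
  rw [harmonics]
  infer_instance

theorem harmonics_ne_bot (hd : 3 ≤ d) (ℓ : ℕ) : harmonics d ℓ ≠ ⊥ := by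
  intro h
  have h1 := finrank_harmonics hd ℓ
  rw [h, finrank_bot, Nat.cast_zero, harmonicsDim, gegenbauer_one] at h1
  have hlam := half_dim_sub_two_pos hd
  have h2 := poch_pos (mul_pos two_pos hlam) ℓ
  have h3 : (0 : ℝ) < ((ℓ : ℝ) + ((d : ℝ) - 2) / 2) / (((d : ℝ) - 2) / 2) *
      (poch (2 * (((d : ℝ) - 2) / 2)) ℓ / ℓ.factorial) := by positivity
  exact h3.ne h1

theorem hasEigenvalue_integralOp_iff (hd : 3 ≤ d) (c : ℝ) :
    (integralOp d).HasEigenvalue c ↔ c ∈ Set.range (beta d) := by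
  rw [Module.End.hasEigenvalue_iff, eigenspace_integralOp hd]
  constructor
  · intro h
    by_contra hc
    refine h ?_
    have : IsEmpty {ℓ // beta d ℓ = c} := ⟨fun ℓ => hc ⟨ℓ, ℓ.2⟩⟩
    rw [iSup_of_empty]
    exact (Submodule.closed_of_finiteDimensional (⊥ : Submodule ℝ (L2 d))).submodule_topologicalClosure_eq
  · rintro ⟨ℓ, rfl⟩ h
    refine harmonics_ne_bot hd ℓ (le_bot_iff.1 ?_)
    rw [← h]
    exact (le_iSup (fun m : {m // beta d m = beta d ℓ} => harmonics d m) ⟨ℓ, rfl⟩).trans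
      (Submodule.le_topologicalClosure _)

/-- No other index shares this eigenvalue, and a finite-dimensional space is already closed. -/
theorem eigenspace_beta (hd : 3 ≤ d) {ℓ : ℕ} (hℓ : ℓ = 1 ∨ Even ℓ) :
    (integralOp d).eigenspace (beta d ℓ) = harmonics d ℓ := by
  have h : (⨆ m : {m // beta d m = beta d ℓ}, harmonics d m) = harmonics d ℓ := by
    refine le_antisymm (iSup_le fun m => ?_)
      (le_iSup (fun m : {m // beta d m = beta d ℓ} => harmonics d m) ⟨ℓ, rfl⟩)
    rw [eq_of_beta_eq hd hℓ m.2]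
  rw [eigenspace_integralOp hd, h]
  exact (Submodule.closed_of_finiteDimensional _).submodule_topologicalClosure_eq

theorem eigenspace_zero (hd : 3 ≤ d) : (integralOp d).eigenspace 0 =
    (⨆ k : ℕ, harmonics d (2 * (k + 1) + 1)).topologicalClosure := by
  rw [eigenspace_integralOp hd]
  congr 1
  refine le_antisymm (iSup_le fun m => ?_) (iSup_le fun k => ?_)
  · obtain ⟨m, hm⟩ := m
    rcases eq_one_or_even_or_odd m with h | ⟨k, rfl⟩
    · exact absurd hm (beta_pos hd h).ne'
    · exact le_iSup (fun k : ℕ => harmonics d (2 * (k + 1) + 1)) k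
  · exact le_iSup (fun m : {m // beta d m = 0} => harmonics d m)
      ⟨2 * (k + 1) + 1, beta_odd hd (by omega)⟩

theorem isKthLargestEigenvalue_one (hd : 3 ≤ d) :
    IsKthLargestEigenvalue (integralOp d) 1 (beta d 1) := by
  refine ⟨(hasEigenvalue_integralOp_iff hd _).2 ⟨1, rfl⟩, ?_⟩
  have h : {c' : ℝ | (integralOp d).HasEigenvalue c' ∧ beta d 1 < c'} = ∅ := by
    rw [Set.eq_empty_iff_forall_notMem]
    rintro c ⟨hc, hlt⟩
    obtain ⟨ℓ, rfl⟩ := (hasEigenvalue_integralOp_iff hd c).1 hc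
    rcases eq_one_or_even_or_odd ℓ with (rfl | hℓ) | ⟨k, rfl⟩
    · exact lt_irrefl _ hlt
    · exact lt_asymm hlt (beta_even_lt_beta_one hd hℓ)
    · rw [beta_odd hd (by omega)] at hlt
      exact lt_asymm hlt (beta_pos hd (Or.inl rfl))
  rw [h]
  simp

theorem isKthLargestEigenvalue_add_two (hd : 3 ≤ d) (j : ℕ) :
    IsKthLargestEigenvalue (integralOp d) (j + 2) (beta d (2 * j)) := by
  refine ⟨(hasEigenvalue_integralOp_iff hd _).2 ⟨2 * j, rfl⟩, ?_⟩
  have hinj := (strictAnti_beta_even hd).injective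
  -- The larger eigenvalues are `β₁` and the `j` values `β_{2i}` with `i < j`: `j + 1` in all,
  -- giving rank `j + 2`.
  have h : {c' : ℝ | (integralOp d).HasEigenvalue c' ∧ beta d (2 * j) < c'} =
      ((insert (beta d 1) ((Finset.range j).image fun i => beta d (2 * i)) : Finset ℝ) :
        Set ℝ) := by
    ext c
    simp only [Set.mem_ofPred_eq, Finset.coe_insert, Finset.coe_image, Set.mem_insert_iff,
      Set.mem_image, Finset.coe_range, Set.mem_Iio, hasEigenvalue_integralOp_iff hd]
    constructor
    · rintro ⟨⟨ℓ, rfl⟩, hlt⟩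
      rcases eq_one_or_even_or_odd ℓ with (rfl | hℓ) | ⟨k, rfl⟩
      · exact Or.inl rfl
      · obtain ⟨i, rfl⟩ := hℓ.exists_two_nsmul
        rw [nsmul_eq_mul, Nat.cast_ofNat] at hlt ⊢
        exact Or.inr ⟨i, (strictAnti_beta_even hd).lt_iff_gt.1 hlt, rfl⟩
      · rw [beta_odd hd (by omega)] at hlt
        exact absurd hlt (beta_pos_of_even hd (even_two_mul j)).not_gt
    · rintro (rfl | ⟨i, hi, rfl⟩)
      · exact ⟨⟨1, rfl⟩, beta_even_lt_beta_one hd (even_two_mul j)⟩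
      · exact ⟨⟨2 * i, rfl⟩, strictAnti_beta_even hd hi⟩
  rw [h, Set.encard_coe_eq_coe_finsetCard, Finset.card_insert_of_notMem,
    Finset.card_image_of_injective _ hinj, Finset.card_range]
  · norm_cast
  · intro hmem
    obtain ⟨i, _, hi⟩ := Finset.mem_image.1 hmem
    exact (beta_even_lt_beta_one hd (even_two_mul i)).ne hi

theorem orthonormal_harmonics (hd : 3 ≤ d) (Y : ∀ ℓ : ℕ,
    OrthonormalBasis (Fin (Module.finrank ℝ (harmonics d ℓ))) ℝ (harmonics d ℓ)) :
    Orthonormal ℝ (fun p : (Σ ℓ : ℕ, Fin (Module.finrank ℝ (harmonics d ℓ))) =>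
      (Y p.1 p.2 : L2 d)) := by
  constructor
  · rintro ⟨ℓ, i⟩
    exact (Y ℓ).orthonormal.1 i
  · rintro ⟨ℓ, i⟩ ⟨m, j⟩ hne
    by_cases hlm : ℓ = m
    · subst hlm
      exact (Y ℓ).orthonormal.2 fun hij => hne (congrArg (Sigma.mk ℓ) hij)
    · exact inner_eq_zero_of_mem_harmonics hd hlm (Y ℓ i).2 (Y m j).2

theorem topologicalClosure_span_harmonics (hd : 3 ≤ d) (Y : ∀ ℓ : ℕ,
    OrthonormalBasis (Fin (Module.finrank ℝ (harmonics d ℓ))) ℝ (harmonics d ℓ)) :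
    (Submodule.span ℝ (Set.range (fun p : (Σ ℓ : ℕ, Fin (Module.finrank ℝ (harmonics d ℓ))) =>
      (Y p.1 p.2 : L2 d)))).topologicalClosure = ⊤ := by
  rw [eq_top_iff, ← topologicalClosure_iSup_harmonics (by omega : 2 ≤ d)]
  refine Submodule.topologicalClosure_mono (iSup_le fun ℓ => ?_)
  have h := congrArg (Submodule.map (harmonics d ℓ).subtype) (Y ℓ).toBasis.span_eq
  rw [Submodule.map_span, Submodule.map_top, Submodule.range_subtype] at h
  rw [← h]
  refine Submodule.span_mono ?_
  rintro _ ⟨_, ⟨i, rfl⟩, rfl⟩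
  exact ⟨⟨ℓ, i⟩, by simp⟩

end Eigenvalues

end NTKSphere

end

open NTKSphere
theorem mainTheorem4 (d : ℕ) (hd : 3 ≤ d)
    (Y : ∀ ℓ : ℕ, OrthonormalBasis (Fin (Module.finrank ℝ (harmonics d ℓ))) ℝ (harmonics d ℓ)) :
    -- the dimension of the space of spherical harmonics of degree `ℓ` is `N_ℓ`
    (∀ ℓ : ℕ, (Module.finrank ℝ (harmonics d ℓ) : ℝ) = harmonicsDim d ℓ) ∧
    -- the series defining the `β_ℓ` converge
    (∀ ℓ : ℕ, Summable (betaTerm d profile ℓ)) ∧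
    -- the `Y_{ℓ,i}` are eigenfunctions for `β_ℓ`, and form a complete orthonormal system
    (∀ (ℓ : ℕ) (i : Fin (Module.finrank ℝ (harmonics d ℓ))),
      integralOp d (Y ℓ i : L2 d) = beta d ℓ • (Y ℓ i : L2 d)) ∧
    Orthonormal ℝ (fun p : (Σ ℓ : ℕ, Fin (Module.finrank ℝ (harmonics d ℓ))) =>
      (Y p.1 p.2 : L2 d)) ∧
    (Submodule.span ℝ (Set.range (fun p : (Σ ℓ : ℕ, Fin (Module.finrank ℝ (harmonics d ℓ))) =>
      (Y p.1 p.2 : L2 d)))).topologicalClosure = ⊤ ∧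
    -- the eigenvalues are exactly the `β_ℓ`
    {c : ℝ | (integralOp d).HasEigenvalue c} = Set.range (beta d) ∧
    -- multiplicities: the eigenspaces of the nonzero eigenvalues, and the kernel
    (∀ ℓ : ℕ, (ℓ = 1 ∨ Even ℓ) →
      0 < beta d ℓ ∧ (integralOp d).eigenspace (beta d ℓ) = harmonics d ℓ) ∧
    (integralOp d).eigenspace 0 =
      (⨆ k : ℕ, harmonics d (2 * (k + 1) + 1)).topologicalClosure ∧
    -- the values `β_ℓ`
    (∀ k : ℕ, 1 ≤ k → beta d (2 * k + 1) = 0) ∧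
    (∀ ℓ : ℕ, 2 ≤ ℓ → beta d ℓ ≤ beta d (ℓ - 2)) ∧
    beta d 1 = 1 / (4 * (d : ℝ)) ∧
    beta d 0 < beta d 1 ∧
    -- `λ_1 = β_1` and `λ_k = β_{2(k-2)}` for `k ≥ 2`
    IsKthLargestEigenvalue (integralOp d) 1 (beta d 1) ∧
    (∀ k : ℕ, 2 ≤ k → IsKthLargestEigenvalue (integralOp d) k (beta d (2 * (k - 2)))) := by
  refine ⟨finrank_harmonics hd, summable_betaTerm hd,
    fun ℓ i => integralOp_of_mem_harmonics hd (Y ℓ i).2, orthonormal_harmonics hd Y,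
    topologicalClosure_span_harmonics hd Y, Set.ext (hasEigenvalue_integralOp_iff hd),
    fun ℓ hℓ => ⟨beta_pos hd hℓ, eigenspace_beta hd hℓ⟩, eigenspace_zero hd,
    fun k hk => beta_odd hd hk, fun ℓ hℓ => ?_, beta_one hd, beta_zero_lt hd,
    isKthLargestEigenvalue_one hd, fun k hk => ?_⟩
  · obtain ⟨m, rfl⟩ := Nat.exists_eq_add_of_le' hℓ
    exact beta_add_two_le hd m
  · obtain ⟨j, rfl⟩ := Nat.exists_eq_add_of_le' hk
    exact isKthLargestEigenvalue_add_two hd j
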